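/- For an integer $n\ge 1$ and an $n$-bit integer $k$, that is $2^{n-1}\le k<2^n$, with binary expansion $k=\sum_{j=0}^{n-1}\varepsilon_j(k)\,2^j$, $\varepsilon_j(k)\in\{0,1\}$, let $\overleftarrow{k}=\sum_{j=0}^{n-1}\varepsilon_j(k)\,2^{n-1-j}$ denote its binary reversal. Let $$\Theta(n)=\bigl|\{\,2^{n-1}\le p<2^n : p \text{ and } \overleftarrow{p} \text{ are both prime}\,\}\bigr|.$$ Then $\Theta(n)\ll 2^n/n^2$ for all $n\ge 1$; that is, there is an absolute constant $C>0$ such that $$\Theta(n)\le C\,\frac{2^n}{n^2}\qquad\text{for every integer } n\ge 1.$$ -/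

import Mathlib

/-- The `j`-th binary digit `ε_j(k)` of `k` (with `j = 0` the least significant one). -/
def binaryDigit (j k : ℕ) : ℕ := k / 2 ^ j % 2

/-- The reversal of an `n`-bit integer `k`: if `k = ∑_{j < n} ε_j(k) 2 ^ j`, it is
`∑_{j < n} ε_j(k) 2 ^ (n - 1 - j)`. It is used only for `2 ^ (n - 1) ≤ k < 2 ^ n`, where
`n` is the exact number of binary digits of `k`; the subtraction never truncates as `j < n`. -/
def binaryReversal (n k : ℕ) : ℕ :=
  ∑ j ∈ Finset.range n, binaryDigit j k * 2 ^ (n - 1 - j)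

/-- The set of `n`-bit primes (`n ≥ 1`) whose binary reversal is also prime. -/
def reversiblePrimes (n : ℕ) : Finset ℕ :=
  {p ∈ Finset.Ico (2 ^ (n - 1)) (2 ^ n) | p.Prime ∧ (binaryReversal n p).Prime}

/-- The number `Θ(n)` of `n`-bit reversible primes. -/
def reversiblePrimeCount (n : ℕ) : ℕ := (reversiblePrimes n).card

open Finset

/-- The additive character `x ↦ exp (2πix)`. -/
noncomputable def unitExp (x : ℝ) : ℂ := Complex.exp (2 * Real.pi * x * Complex.I)

theorem unitExp_add (x y : ℝ) : unitExp (x + y) = unitExp x * unitExp y := by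
  simp only [unitExp, ← Complex.exp_add]
  congr 1
  push_cast
  ring

@[simp] theorem unitExp_zero : unitExp 0 = 1 := by simp [unitExp]

@[simp] theorem norm_unitExp (x : ℝ) : ‖unitExp x‖ = 1 := by
  have : (2 * Real.pi * x * Complex.I : ℂ) = ((2 * Real.pi * x : ℝ) : ℂ) * Complex.I := by
    push_cast; ring
  rw [unitExp, this, Complex.norm_exp_ofReal_mul_I]

theorem conj_unitExp (x : ℝ) : (starRingEnd ℂ) (unitExp x) = unitExp (-x) := by
  rw [unitExp, unitExp, ← Complex.exp_conj]
  congr 1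
  simp [Complex.conj_ofReal, Complex.conj_ofNat]

theorem unitExp_natCast_mul (n : ℕ) (x : ℝ) : unitExp (n * x) = unitExp x ^ n := by
  rw [unitExp, unitExp, ← Complex.exp_nat_mul]
  congr 1
  push_cast
  ring

theorem unitExp_intCast (z : ℤ) : unitExp z = 1 := by
  rw [unitExp, Complex.exp_eq_one_iff]
  exact ⟨z, by push_cast; ring⟩

theorem unitExp_add_intCast (x : ℝ) (z : ℤ) : unitExp (x + z) = unitExp x := by
  rw [unitExp_add, unitExp_intCast, mul_one]

theorem unitExp_eq_cos_add_sin (x : ℝ) :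
    unitExp x = ⟨Real.cos (2 * Real.pi * x), Real.sin (2 * Real.pi * x)⟩ := by
  have : (2 * Real.pi * x * Complex.I : ℂ) = ((2 * Real.pi * x : ℝ) : ℂ) * Complex.I := by
    push_cast; ring
  rw [unitExp, this, Complex.exp_mul_I, ← Complex.ofReal_cos, ← Complex.ofReal_sin]
  exact (Complex.mk_eq_add_mul_I _ _).symm

theorem normSq_add_mul_unitExp (a b x : ℝ) :
    ‖(a : ℂ) + b * unitExp x‖ ^ 2 = a ^ 2 + b ^ 2 + 2 * a * b * Real.cos (2 * Real.pi * x) := by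
  rw [Complex.sq_norm, Complex.normSq_apply, unitExp_eq_cos_add_sin]
  simp
  nlinarith [Real.sin_sq_add_cos_sq (2 * Real.pi * x)]

theorem norm_one_add_unitExp (x : ℝ) : ‖1 + unitExp x‖ = 2 * |Real.cos (Real.pi * x)| := by
  have h := normSq_add_mul_unitExp 1 1 x
  rw [← abs_norm, ← abs_two, ← abs_mul, ← sq_eq_sq_iff_abs_eq_abs]
  simp only [Complex.ofReal_one, one_mul] at h
  rw [h, mul_assoc 2 Real.pi x, Real.cos_two_mul]
  ring

theorem norm_one_sub_unitExp (x : ℝ) : ‖1 - unitExp x‖ = 2 * |Real.sin (Real.pi * x)| := by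
  have h := normSq_add_mul_unitExp 1 (-1) x
  rw [← abs_norm, ← abs_two, ← abs_mul, ← sq_eq_sq_iff_abs_eq_abs]
  simp only [Complex.ofReal_one, Complex.ofReal_neg, neg_mul, one_mul, ← sub_eq_add_neg] at h
  rw [h, mul_assoc 2 Real.pi x, Real.cos_two_mul]
  nlinarith [Real.sin_sq_add_cos_sq (Real.pi * x)]

theorem unitExp_sum {ι : Type*} (s : Finset ι) (f : ι → ℝ) :
    unitExp (∑ i ∈ s, f i) = ∏ i ∈ s, unitExp (f i) := by
  classical
  induction s using Finset.induction_on with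
  | empty => simp
  | insert a s ha ih => rw [sum_insert ha, prod_insert ha, unitExp_add, ih]

theorem binaryDigit_add_two_pow_of_lt {j n : ℕ} (h : j < n) (k : ℕ) :
    binaryDigit j (2 ^ n + k) = binaryDigit j k := by
  obtain ⟨i, rfl⟩ := Nat.exists_eq_add_of_lt h
  have : 2 ^ (j + i + 1) + k = k + 2 ^ j * (2 * 2 ^ i) := by ring
  rw [binaryDigit, binaryDigit, this, Nat.add_mul_div_left _ _ (by positivity),
    Nat.add_mul_mod_self_left]

theorem binaryDigit_add_two_pow_self {n k : ℕ} (h : k < 2 ^ n) :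
    binaryDigit n (2 ^ n + k) = 1 := by
  rw [binaryDigit, Nat.add_div_left _ (by positivity), Nat.div_eq_of_lt h]

theorem binaryDigit_of_lt {n k : ℕ} (h : k < 2 ^ n) : binaryDigit n k = 0 := by
  rw [binaryDigit, Nat.div_eq_of_lt h]

theorem sum_binaryDigit_mul_two_pow (n k : ℕ) :
    ∑ j ∈ range n, binaryDigit j k * 2 ^ j = k % 2 ^ n := by
  induction n with
  | zero => simp [Nat.mod_one]
  | succ n ih => rw [sum_range_succ, ih, Nat.mod_pow_succ, binaryDigit, mul_comm]

/-- Summing a product over binary digits over all `n`-digit strings gives a product. -/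
theorem sum_prod_binaryDigit {R : Type*} [CommSemiring R] (n : ℕ) (f : ℕ → ℕ → R) :
    ∑ k ∈ range (2 ^ n), ∏ j ∈ range n, f j (binaryDigit j k) =
      ∏ j ∈ range n, (f j 0 + f j 1) := by
  induction n with
  | zero => simp
  | succ n ih =>
    rw [pow_succ, mul_two, sum_range_add, prod_range_succ, ← ih, mul_add, sum_mul, sum_mul]
    congr 1
    · refine sum_congr rfl fun k hk => ?_
      rw [prod_range_succ, binaryDigit_of_lt (mem_range.1 hk)]
    · refine sum_congr rfl fun k hk => ?_
      rw [prod_range_succ, binaryDigit_add_two_pow_self (mem_range.1 hk)]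
      congr 1
      refine prod_congr rfl fun j hj => ?_
      rw [binaryDigit_add_two_pow_of_lt (mem_range.1 hj)]

theorem sum_unitExp_add_binaryReversal (n : ℕ) (x y : ℝ) :
    ∑ k ∈ range (2 ^ n), unitExp (x * k + y * binaryReversal n k) =
      ∏ j ∈ range n, (1 + unitExp (x * 2 ^ j + y * 2 ^ (n - 1 - j))) := by
  have h := sum_prod_binaryDigit n
    (fun j d => unitExp (d * (x * 2 ^ j + y * 2 ^ (n - 1 - j))))
  simp only [Nat.cast_zero, zero_mul, unitExp_zero, Nat.cast_one, one_mul] at h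
  rw [← h]
  refine sum_congr rfl fun k hk => ?_
  rw [← unitExp_sum]
  congr 1
  have h1 := sum_binaryDigit_mul_two_pow n k
  rw [Nat.mod_eq_of_lt (mem_range.1 hk)] at h1
  conv_lhs => rw [← h1, binaryReversal]
  rw [Nat.cast_sum, Nat.cast_sum, mul_sum, mul_sum, ← sum_add_distrib]
  refine sum_congr rfl fun j _ => ?_
  rw [h1]
  push_cast
  ring

/-- A Riesz product is a trigonometric polynomial with explicit `ℓ²` norm. -/
theorem exists_riesz_coeff (m : ℕ) (a b : ℕ → ℂ) :
    ∃ c : ℕ → ℂ, (∀ x : ℝ, ∏ j ∈ range m, (a j + b j * unitExp (2 ^ j * x)) =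
        ∑ k ∈ range (2 ^ m), c k * unitExp (k * x)) ∧
      ∑ k ∈ range (2 ^ m), ‖c k‖ ^ 2 = ∏ j ∈ range m, (‖a j‖ ^ 2 + ‖b j‖ ^ 2) := by
  refine ⟨fun k => ∏ j ∈ range m, if binaryDigit j k = 0 then a j else b j, fun x => ?_, ?_⟩
  · have h := sum_prod_binaryDigit m
      (fun j d => (if d = 0 then a j else b j) * unitExp (d * (2 ^ j * x)))
    simp only [if_true, one_ne_zero, if_false, Nat.cast_zero, zero_mul, unitExp_zero, mul_one,
      Nat.cast_one, one_mul] at h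
    rw [← h]
    refine sum_congr rfl fun k hk => ?_
    rw [prod_mul_distrib, ← unitExp_sum]
    congr 2
    have h1 := sum_binaryDigit_mul_two_pow m k
    rw [Nat.mod_eq_of_lt (mem_range.1 hk)] at h1
    have h2 : (k : ℝ) = ∑ j ∈ range m, (binaryDigit j k : ℝ) * 2 ^ j := by
      exact_mod_cast h1.symm
    rw [h2, sum_mul]
    exact sum_congr rfl fun j _ => by ring
  · have h := sum_prod_binaryDigit m (fun j d => (if d = 0 then ‖a j‖ ^ 2 else ‖b j‖ ^ 2))
    simp only [if_true, one_ne_zero, if_false] at h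
    rw [← h]
    refine sum_congr rfl fun k _ => ?_
    rw [norm_prod, ← prod_pow]
    refine prod_congr rfl fun j _ => ?_
    split_ifs <;> rfl

theorem sum_range_one_div_succ_sq_le (N : ℕ) :
    ∑ r ∈ range N, 1 / ((r : ℝ) + 1) ^ 2 ≤ 2 := by
  have h : ∀ N : ℕ, ∑ r ∈ range (N + 1), 1 / ((r : ℝ) + 1) ^ 2 ≤ 2 - 1 / ((N : ℝ) + 1) := by
    intro N
    induction N with
    | zero => norm_num
    | succ N ih =>
      rw [sum_range_succ]
      refine (add_le_add_left ih _).trans ?_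
      have h1 : (0 : ℝ) < (N : ℝ) + 1 := by positivity
      have h2 : (0 : ℝ) < (N : ℝ) + 1 + 1 := by positivity
      push_cast
      have : 1 / ((N : ℝ) + 1 + 1) ^ 2 ≤ 1 / ((N : ℝ) + 1) - 1 / ((N : ℝ) + 1 + 1) := by
        rw [div_sub_div _ _ h1.ne' h2.ne', div_le_div_iff₀ (by positivity) (by positivity)]
        nlinarith
      linarith
  cases N with
  | zero => simp
  | succ N => exact (h N).trans (by have : (0 : ℝ) ≤ 1 / ((N : ℝ) + 1) := by positivity
                                    linarith)

theorem two_mul_le_sin_pi_mul {x : ℝ} (h0 : 0 ≤ x) (h1 : x ≤ 1 / 2) :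
    2 * x ≤ Real.sin (Real.pi * x) := by
  have h := Real.mul_le_sin (x := Real.pi * x) (by positivity)
    (by nlinarith [Real.pi_pos])
  have h2 : 2 / Real.pi * (Real.pi * x) = 2 * x := by field_simp
  linarith

/-- The Dirichlet kernel `∑_{i < M} exp (2πi i x)`. -/
noncomputable def dirichletSum (M : ℕ) (x : ℝ) : ℂ := ∑ i ∈ range M, unitExp (i * x)

theorem norm_dirichletSum_le (M : ℕ) (x : ℝ) : ‖dirichletSum M x‖ ≤ M := by
  refine (norm_sum_le _ _).trans ?_
  simp

theorem norm_dirichletSum_mul_sin_le (M : ℕ) (x : ℝ) :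
    ‖dirichletSum M x‖ * |Real.sin (Real.pi * x)| ≤ 1 := by
  have h : dirichletSum M x * (1 - unitExp x) = 1 - unitExp (M * x) := by
    simp only [dirichletSum, unitExp_natCast_mul]
    exact geom_sum_mul_neg _ _
  have h2 := congrArg norm h
  rw [norm_mul, norm_one_sub_unitExp] at h2
  have h3 : ‖1 - unitExp (M * x)‖ ≤ 2 := by
    refine (norm_sub_le _ _).trans ?_
    rw [norm_unitExp, norm_one]; norm_num
  nlinarith

theorem norm_dirichletSum_sq_le_one_div {M : ℕ} {x y : ℝ} (hy : 0 < y)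
    (h : 2 * y ≤ |Real.sin (Real.pi * x)|) : ‖dirichletSum M x‖ ^ 2 ≤ 1 / (4 * y ^ 2) := by
  have h1 := norm_dirichletSum_mul_sin_le M x
  have h2 : ‖dirichletSum M x‖ * (2 * y) ≤ 1 :=
    (mul_le_mul_of_nonneg_left h (norm_nonneg _)).trans h1
  rw [le_div_iff₀ (by positivity)]
  have h3 : 0 ≤ ‖dirichletSum M x‖ * (2 * y) := by positivity
  nlinarith

theorem norm_dirichletSum_fract (M : ℕ) (x : ℝ) :
    dirichletSum M (Int.fract x) = dirichletSum M x := by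
  refine sum_congr rfl fun i _ => ?_
  have : (i : ℝ) * x = i * Int.fract x + ((i * ⌊x⌋ : ℤ) : ℝ) := by
    push_cast
    rw [← mul_add, Int.fract_add_floor]
  rw [this, unitExp_add_intCast]

theorem one_div_le_of_cell {N r : ℕ} {x : ℝ} (hr : 1 ≤ r) (hN : 0 < N) (h : (r : ℝ) / N ≤ x) :
    1 / (4 * x ^ 2) ≤ (N : ℝ) ^ 2 * (4 * (1 / ((r : ℝ) + 1) ^ 2)) := by
  have hN' : (0 : ℝ) < N := by exact_mod_cast hN
  have hr' : (1 : ℝ) ≤ r := by exact_mod_cast hr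
  rw [div_le_iff₀ hN'] at h
  have hx : 0 < x := by
    by_contra hx
    push Not at hx
    nlinarith
  have h4 : ((r : ℝ) + 1) ^ 2 ≤ 16 * x ^ 2 * N ^ 2 := by
    have : (r : ℝ) + 1 ≤ 4 * (x * N) := by linarith
    nlinarith
  rw [← sub_nonneg]
  have : (N : ℝ) ^ 2 * (4 * (1 / ((r : ℝ) + 1) ^ 2)) - 1 / (4 * x ^ 2) =
      (16 * x ^ 2 * N ^ 2 - (r + 1) ^ 2) / (4 * x ^ 2 * (r + 1) ^ 2) := by
    field_simp
    ring
  rw [this]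
  exact div_nonneg (by linarith) (by positivity)

theorem norm_dirichletSum_sq_le_cell {N : ℕ} (hN : 0 < N) (x : ℝ) :
    ‖dirichletSum (2 * N) x‖ ^ 2 ≤ (N : ℝ) ^ 2 *
      (4 * (1 / ((⌊N * Int.fract x⌋₊ : ℝ) + 1) ^ 2) +
        4 * (1 / (((N - 1 - ⌊N * Int.fract x⌋₊ : ℕ) : ℝ) + 1) ^ 2)) := by
  have hN' : (0 : ℝ) < N := by exact_mod_cast hN
  rw [← norm_dirichletSum_fract]
  have h0 := Int.fract_nonneg x
  have h1 := Int.fract_lt_one x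
  set t := Int.fract x with ht
  clear_value t
  set r := ⌊N * t⌋₊ with hr
  have hr1 : (r : ℝ) ≤ N * t := Nat.floor_le (by positivity)
  have hr2 : N * t < r + 1 := Nat.lt_floor_add_one _
  have hrN : r < N := by
    have : (r : ℝ) < N := hr1.trans_lt (by nlinarith)
    exact_mod_cast this
  have htriv : ‖dirichletSum (2 * N) t‖ ^ 2 ≤ (N : ℝ) ^ 2 * 4 := by
    have := norm_dirichletSum_le (2 * N) t
    push_cast at this
    nlinarith [norm_nonneg (dirichletSum (2 * N) t)]
  have hA : 0 ≤ (N : ℝ) ^ 2 * (4 * (1 / ((r : ℝ) + 1) ^ 2)) := by positivity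
  have hB : 0 ≤ (N : ℝ) ^ 2 * (4 * (1 / (((N - 1 - r : ℕ) : ℝ) + 1) ^ 2)) := by positivity
  rw [mul_add]
  rcases Nat.eq_zero_or_pos r with h | h
  · rw [h] at hB ⊢
    simp only [Nat.cast_zero] at hB ⊢
    norm_num at hB ⊢
    linarith
  rcases Nat.eq_zero_or_pos (N - 1 - r) with h' | h'
  · rw [h'] at hB ⊢
    simp only [Nat.cast_zero] at hB ⊢
    norm_num at hA hB ⊢
    linarith
  rcases le_total t (1 / 2) with ht2 | ht2
  · have htr : (r : ℝ) / N ≤ t := by rw [div_le_iff₀ hN']; linarith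
    have htpos : 0 < t := lt_of_lt_of_le (by positivity) htr
    have := norm_dirichletSum_sq_le_one_div (M := 2 * N) htpos
      ((two_mul_le_sin_pi_mul h0 ht2).trans (le_abs_self _))
    have := one_div_le_of_cell h hN htr
    linarith
  · have htr : ((N - 1 - r : ℕ) : ℝ) / N ≤ 1 - t := by
      rw [div_le_iff₀ hN']
      have : ((N - 1 - r : ℕ) : ℝ) = N - 1 - r := by
        rw [Nat.cast_sub (by omega), Nat.cast_sub (by omega)]; simp
      rw [this]; linarith
    have htpos : 0 < 1 - t := by linarith
    have hs : 2 * (1 - t) ≤ |Real.sin (Real.pi * t)| := by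
      have := two_mul_le_sin_pi_mul (x := 1 - t) (by linarith) (by linarith)
      rw [mul_sub Real.pi, mul_one, Real.sin_pi_sub] at this
      exact this.trans (le_abs_self _)
    have := norm_dirichletSum_sq_le_one_div (M := 2 * N) htpos hs
    have := one_div_le_of_cell h' hN htr
    linarith

/-- The points `y i`, `i ∈ s`, are pairwise at distance at least `1 / N` modulo `1`. -/
def WellSpaced {ι : Type*} (s : Finset ι) (y : ι → ℝ) (N : ℕ) : Prop :=
  ∀ i ∈ s, ∀ j ∈ s, i ≠ j → ∀ z : ℤ, 1 / (N : ℝ) ≤ |y i - y j - z|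

theorem WellSpaced.sum_dirichletSum_le {ι : Type*} {s : Finset ι} {y : ι → ℝ} {N : ℕ}
    (h : WellSpaced s y N) (hN : 0 < N) (i : ι) :
    ∑ j ∈ s, ‖dirichletSum (2 * N) (y i - y j)‖ ^ 2 ≤ 16 * (N : ℝ) ^ 2 := by
  classical
  have hN' : (0 : ℝ) < N := by exact_mod_cast hN
  set g : ι → ℕ := fun j => ⌊N * Int.fract (y i - y j)⌋₊ with hg
  set w : ℕ → ℝ := fun r => (N : ℝ) ^ 2 * (4 * (1 / ((r : ℝ) + 1) ^ 2) +
        4 * (1 / (((N - 1 - r : ℕ) : ℝ) + 1) ^ 2)) with hw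
  have hinj : Set.InjOn g s := by
    intro j hj k hk hjk
    by_contra hne
    have hsp := h j hj k hk hne (⌊y i - y k⌋ - ⌊y i - y j⌋)
    have e : y j - y k - ((⌊y i - y k⌋ - ⌊y i - y j⌋ : ℤ) : ℝ) =
        Int.fract (y i - y k) - Int.fract (y i - y j) := by
      rw [Int.fract, Int.fract]; push_cast; ring
    rw [e, div_le_iff₀ hN'] at hsp
    have a1 := Nat.floor_le (a := N * Int.fract (y i - y j))
      (mul_nonneg hN'.le (Int.fract_nonneg _))
    have a2 := Nat.lt_floor_add_one (N * Int.fract (y i - y j))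
    have b1 := Nat.floor_le (a := N * Int.fract (y i - y k))
      (mul_nonneg hN'.le (Int.fract_nonneg _))
    have b2 := Nat.lt_floor_add_one (N * Int.fract (y i - y k))
    have e2 : (⌊N * Int.fract (y i - y j)⌋₊ : ℝ) = ⌊N * Int.fract (y i - y k)⌋₊ := by
      exact_mod_cast hjk
    have : |Int.fract (y i - y k) - Int.fract (y i - y j)| * N < 1 := by
      rw [← abs_of_pos hN', ← abs_mul, abs_lt]
      constructor <;> nlinarith
    linarith
  have hsub : s.image g ⊆ range N := by
    intro r hr
    obtain ⟨j, -, rfl⟩ := mem_image.1 hr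
    rw [mem_range, hg]
    have := Int.fract_lt_one (y i - y j)
    exact (Nat.floor_lt (mul_nonneg hN'.le (Int.fract_nonneg _))).2 (by nlinarith)
  calc ∑ j ∈ s, ‖dirichletSum (2 * N) (y i - y j)‖ ^ 2 ≤ ∑ j ∈ s, w (g j) :=
        sum_le_sum fun j _ => norm_dirichletSum_sq_le_cell hN _
    _ = ∑ r ∈ s.image g, w r := (sum_image hinj).symm
    _ ≤ ∑ r ∈ range N, w r := sum_le_sum_of_subset_of_nonneg hsub fun _ _ _ => by
        simp only [hw]; positivity
    _ = (N : ℝ) ^ 2 * (4 * ∑ r ∈ range N, 1 / ((r : ℝ) + 1) ^ 2 +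
          4 * ∑ r ∈ range N, 1 / ((r : ℝ) + 1) ^ 2) := by
        rw [hw, ← mul_sum, sum_add_distrib, ← mul_sum, ← mul_sum,
          sum_range_reflect (fun r : ℕ => 1 / ((r : ℝ) + 1) ^ 2)]
    _ ≤ 16 * (N : ℝ) ^ 2 := by
        have := sum_range_one_div_succ_sq_le N
        nlinarith [sq_nonneg (N : ℝ)]

theorem sum_sum_norm_sq_expSum {ι : Type*} (s : Finset ι) (y : ι → ℝ) (M : ℕ) (b : ι → ℂ) :
    ((∑ p ∈ range M, ∑ q ∈ range M,
      ‖∑ i ∈ s, b i * unitExp (((q : ℝ) - p) * y i)‖ ^ 2 : ℝ) : ℂ) =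
      ∑ i ∈ s, ∑ j ∈ s, b i * (starRingEnd ℂ) (b j) *
        ((‖dirichletSum M (y i - y j)‖ ^ 2 : ℝ) : ℂ) := by
  have h1 : ∀ p q : ℕ, ((‖∑ i ∈ s, b i * unitExp (((q : ℝ) - p) * y i)‖ ^ 2 : ℝ) : ℂ) =
      ∑ i ∈ s, ∑ j ∈ s, b i * (starRingEnd ℂ) (b j) *
        (unitExp (q * (y i - y j)) * (starRingEnd ℂ) (unitExp (p * (y i - y j)))) := by
    intro p q
    push_cast
    rw [← Complex.mul_conj', map_sum, sum_mul_sum]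
    refine sum_congr rfl fun i _ => sum_congr rfl fun j _ => ?_
    rw [map_mul, conj_unitExp, conj_unitExp, mul_mul_mul_comm, ← unitExp_add, ← unitExp_add]
    congr 2
    ring
  have h2 : ∀ x : ℝ, ((‖dirichletSum M x‖ ^ 2 : ℝ) : ℂ) =
      ∑ p ∈ range M, ∑ q ∈ range M, unitExp (q * x) * (starRingEnd ℂ) (unitExp (p * x)) := by
    intro x
    push_cast
    rw [← Complex.mul_conj', dirichletSum, map_sum, sum_mul_sum, sum_comm]
  rw [Complex.ofReal_sum]
  simp only [Complex.ofReal_sum, h1, h2, mul_sum]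
  rw [sum_congr rfl fun p _ => sum_comm, sum_comm]
  refine sum_congr rfl fun i _ => ?_
  rw [sum_congr rfl fun p _ => sum_comm, sum_comm]

theorem WellSpaced.dual_large_sieve {ι : Type*} {s : Finset ι} {y : ι → ℝ} {N : ℕ}
    (h : WellSpaced s y N) (hN : 0 < N) (b : ι → ℂ) :
    ∑ k ∈ range N, ‖∑ i ∈ s, b i * unitExp (k * y i)‖ ^ 2 ≤ 16 * N * ∑ i ∈ s, ‖b i‖ ^ 2 := by
  have hN' : (0 : ℝ) < N := by exact_mod_cast hN
  set B : ℝ → ℝ := fun t => ‖∑ i ∈ s, b i * unitExp (t * y i)‖ ^ 2 with hB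
  have hB0 : ∀ t, 0 ≤ B t := fun t => by positivity
  have h1 : N * ∑ k ∈ range N, B k ≤
      ∑ p ∈ range (2 * N), ∑ q ∈ range (2 * N), B ((q : ℝ) - p) := by
    calc (N : ℝ) * ∑ k ∈ range N, B k = ∑ p ∈ range N, ∑ k ∈ range N, B k := by simp
      _ ≤ ∑ p ∈ range N, ∑ q ∈ range (2 * N), B ((q : ℝ) - p) := by
          refine sum_le_sum fun p hp => ?_
          have : ∑ k ∈ range N, B k = ∑ q ∈ (range N).map (addLeftEmbedding p),
              B ((q : ℝ) - p) := by
            rw [sum_map]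
            refine sum_congr rfl fun k _ => ?_
            congr 1
            simp
          rw [this]
          refine sum_le_sum_of_subset_of_nonneg ?_ fun _ _ _ => hB0 _
          intro q hq
          obtain ⟨k, hk, rfl⟩ := mem_map.1 hq
          simp only [mem_range, addLeftEmbedding_apply] at *
          omega
      _ ≤ _ := sum_le_sum_of_subset_of_nonneg (range_mono (by omega)) fun _ _ _ =>
          sum_nonneg fun _ _ => hB0 _
  have h2 : ∑ p ∈ range (2 * N), ∑ q ∈ range (2 * N), B ((q : ℝ) - p) ≤
      16 * N ^ 2 * ∑ i ∈ s, ‖b i‖ ^ 2 := by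
    have hnn : 0 ≤ ∑ p ∈ range (2 * N), ∑ q ∈ range (2 * N), B ((q : ℝ) - p) :=
      sum_nonneg fun _ _ => sum_nonneg fun _ _ => hB0 _
    have e := congrArg norm (sum_sum_norm_sq_expSum s y (2 * N) b)
    rw [Complex.norm_real, Real.norm_of_nonneg hnn] at e
    have hsymm : ∀ i j, ‖dirichletSum (2 * N) (y i - y j)‖ =
        ‖dirichletSum (2 * N) (y j - y i)‖ := by
      intro i j
      rw [← Complex.norm_conj, dirichletSum, dirichletSum, map_sum]
      simp only [conj_unitExp]
      congr 1
      refine sum_congr rfl fun _ _ => ?_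
      congr 1
      ring
    rw [e]
    calc ‖∑ i ∈ s, ∑ j ∈ s, b i * (starRingEnd ℂ) (b j) *
          ((‖dirichletSum (2 * N) (y i - y j)‖ ^ 2 : ℝ) : ℂ)‖
        ≤ ∑ i ∈ s, ∑ j ∈ s, ‖b i‖ * ‖b j‖ * ‖dirichletSum (2 * N) (y i - y j)‖ ^ 2 := by
          refine (norm_sum_le _ _).trans (sum_le_sum fun i _ => (norm_sum_le _ _).trans
            (sum_le_sum fun j _ => ?_))
          rw [norm_mul, norm_mul, Complex.norm_conj, Complex.norm_real, Real.norm_of_nonneg]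
          positivity
      _ ≤ ∑ i ∈ s, ∑ j ∈ s, (‖b i‖ ^ 2 / 2 * ‖dirichletSum (2 * N) (y i - y j)‖ ^ 2 +
            ‖b j‖ ^ 2 / 2 * ‖dirichletSum (2 * N) (y j - y i)‖ ^ 2) := by
          refine sum_le_sum fun i _ => sum_le_sum fun j _ => ?_
          rw [hsymm j i, ← add_mul]
          refine mul_le_mul_of_nonneg_right ?_ (by positivity)
          nlinarith [sq_nonneg (‖b i‖ - ‖b j‖)]
      _ = ∑ i ∈ s, ‖b i‖ ^ 2 * ∑ j ∈ s, ‖dirichletSum (2 * N) (y i - y j)‖ ^ 2 := by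
          simp only [sum_add_distrib]
          rw [sum_comm (f := fun i j => ‖b j‖ ^ 2 / 2 *
            ‖dirichletSum (2 * N) (y j - y i)‖ ^ 2), ← sum_add_distrib]
          refine sum_congr rfl fun i _ => ?_
          rw [← sum_add_distrib, mul_sum]
          exact sum_congr rfl fun j _ => by ring
      _ ≤ ∑ i ∈ s, ‖b i‖ ^ 2 * (16 * (N : ℝ) ^ 2) := sum_le_sum fun i _ =>
          mul_le_mul_of_nonneg_left (h.sum_dirichletSum_le hN i) (by positivity)
      _ = _ := by rw [← sum_mul]; ring
  have h3 : (N : ℝ) * ∑ k ∈ range N, B k ≤ N * (16 * N * ∑ i ∈ s, ‖b i‖ ^ 2) := by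
    refine (h1.trans h2).trans (le_of_eq ?_)
    ring
  exact le_of_mul_le_mul_left h3 hN'

/-- The analytic large sieve inequality. -/
theorem WellSpaced.large_sieve {ι : Type*} {s : Finset ι} {y : ι → ℝ} {N : ℕ}
    (h : WellSpaced s y N) (hN : 0 < N) (a : ℕ → ℂ) :
    ∑ i ∈ s, ‖∑ k ∈ range N, a k * unitExp (k * y i)‖ ^ 2 ≤
      16 * N * ∑ k ∈ range N, ‖a k‖ ^ 2 := by
  set S : ι → ℂ := fun i => ∑ k ∈ range N, a k * unitExp (k * y i) with hS
  set T : ℝ := ∑ i ∈ s, ‖S i‖ ^ 2 with hT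
  have hT0 : 0 ≤ T := sum_nonneg fun _ _ => by positivity
  set B : ℕ → ℂ := fun k => ∑ i ∈ s, (starRingEnd ℂ) (S i) * unitExp (k * y i) with hB
  have e : (T : ℂ) = ∑ k ∈ range N, a k * B k := by
    rw [hT, Complex.ofReal_sum]
    simp only [hB, mul_sum]
    rw [sum_comm]
    refine sum_congr rfl fun i _ => ?_
    push_cast
    rw [← Complex.mul_conj']
    conv_lhs => rw [hS]
    rw [sum_mul]
    exact sum_congr rfl fun k _ => by ring
  have h1 : T ≤ ∑ k ∈ range N, ‖a k‖ * ‖B k‖ := by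
    have := congrArg norm e
    rw [Complex.norm_real, Real.norm_of_nonneg hT0] at this
    rw [this]
    exact (norm_sum_le _ _).trans (sum_le_sum fun k _ => (norm_mul _ _).le)
  have h2 := sum_mul_sq_le_sq_mul_sq (range N) (fun k => ‖a k‖) (fun k => ‖B k‖)
  have h3 := h.dual_large_sieve hN (fun i => (starRingEnd ℂ) (S i))
  simp only [Complex.norm_conj] at h3
  have hA0 : 0 ≤ ∑ k ∈ range N, ‖a k‖ ^ 2 := sum_nonneg fun _ _ => by positivity
  have h4 : T ^ 2 ≤ (∑ k ∈ range N, ‖a k‖ ^ 2) * (16 * N * T) :=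
    (pow_le_pow_left₀ hT0 h1 2).trans (h2.trans (mul_le_mul_of_nonneg_left h3 hA0))
  rcases hT0.eq_or_lt with h5 | h5
  · rw [← h5]; positivity
  · refine le_of_mul_le_mul_right ?_ h5
    nlinarith

/-- The large sieve inequality for the square of a Riesz product. -/
theorem WellSpaced.sum_riesz_le {ι : Type*} {s : Finset ι} {y : ι → ℝ} {m : ℕ}
    (h : WellSpaced s y (2 ^ m)) (a b : ℕ → ℂ) :
    ∑ i ∈ s, ∏ j ∈ range m, ‖a j + b j * unitExp (2 ^ j * y i)‖ ^ 2 ≤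
      16 * 2 ^ m * ∏ j ∈ range m, (‖a j‖ ^ 2 + ‖b j‖ ^ 2) := by
  obtain ⟨c, hc, hc2⟩ := exists_riesz_coeff m a b
  have := h.large_sieve (by positivity) c
  rw [hc2] at this
  push_cast at this
  refine le_trans (le_of_eq ?_) this
  refine sum_congr rfl fun i _ => ?_
  rw [← hc, norm_prod, prod_pow]

/-- The factor `1 - sin² (πz) / 18`, which dominates `|cos (πx) cos (πy)|` when
`z = 2y - x`. -/
noncomputable def rieszFactor (z : ℝ) : ℝ := 1 - Real.sin (Real.pi * z) ^ 2 / 18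

theorem rieszFactor_nonneg (z : ℝ) : 0 ≤ rieszFactor z := by
  rw [rieszFactor]
  have := Real.sin_sq_le_one (Real.pi * z)
  linarith

theorem rieszFactor_le_one (z : ℝ) : rieszFactor z ≤ 1 := by
  rw [rieszFactor]
  have := sq_nonneg (Real.sin (Real.pi * z))
  linarith

theorem abs_cos_mul_cos_le (x y : ℝ) :
    |Real.cos (Real.pi * x)| * |Real.cos (Real.pi * y)| ≤ rieszFactor (2 * y - x) := by
  have hs : |Real.sin (Real.pi * (2 * y - x))| ≤
      2 * |Real.sin (Real.pi * y)| + |Real.sin (Real.pi * x)| := by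
    have e : Real.pi * (2 * y - x) = 2 * (Real.pi * y) - Real.pi * x := by ring
    rw [e, Real.sin_sub, Real.sin_two_mul]
    refine (abs_sub _ _).trans ?_
    rw [abs_mul, abs_mul, abs_mul, abs_mul, abs_two]
    have h1 := Real.abs_cos_le_one (Real.pi * y)
    have h2 := Real.abs_cos_le_one (Real.pi * x)
    have h3 := Real.abs_cos_le_one (2 * (Real.pi * y))
    have h4 := abs_nonneg (Real.sin (Real.pi * y))
    have h5 := abs_nonneg (Real.sin (Real.pi * x))
    have h6 : |Real.cos (Real.pi * y)| * |Real.cos (Real.pi * x)| ≤ 1 :=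
      mul_le_one₀ h1 (abs_nonneg _) h2
    nlinarith
  refine abs_le_of_sq_le_sq' ?_ (rieszFactor_nonneg _) |>.2
  rw [mul_pow, sq_abs, sq_abs, Real.cos_sq', Real.cos_sq', rieszFactor]
  have hA := Real.sin_sq_le_one (Real.pi * x)
  have hB := Real.sin_sq_le_one (Real.pi * y)
  rw [← sq_abs (Real.sin (Real.pi * x))] at *
  rw [← sq_abs (Real.sin (Real.pi * y))] at *
  rw [← sq_abs (Real.sin (Real.pi * (2 * y - x)))]
  have ha := abs_nonneg (Real.sin (Real.pi * x))
  have hb := abs_nonneg (Real.sin (Real.pi * y))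
  have hc := abs_nonneg (Real.sin (Real.pi * (2 * y - x)))
  generalize |Real.sin (Real.pi * x)| = a at *
  generalize |Real.sin (Real.pi * y)| = b at *
  generalize |Real.sin (Real.pi * (2 * y - x))| = s at *
  have h1 : s ^ 2 ≤ 3 * a ^ 2 + 6 * b ^ 2 := by nlinarith [sq_nonneg (a - b)]
  have h2 : a ^ 2 * b ^ 2 ≤ a ^ 2 := by nlinarith [sq_nonneg a]
  have h3 : a ^ 2 * b ^ 2 ≤ b ^ 2 := by nlinarith [sq_nonneg b]
  nlinarith [sq_nonneg (s ^ 2)]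

/-- The Riesz product `∏_{i < L} (1 - sin² (4 ^ i πx) / 18)`. -/
noncomputable def rieszProd (L : ℕ) (x : ℝ) : ℝ := ∏ i ∈ range L, rieszFactor (4 ^ i * x)

theorem rieszProd_nonneg (L : ℕ) (x : ℝ) : 0 ≤ rieszProd L x :=
  prod_nonneg fun _ _ => rieszFactor_nonneg _

theorem rieszProd_le_one (L : ℕ) (x : ℝ) : rieszProd L x ≤ 1 :=
  prod_le_one (fun _ _ => rieszFactor_nonneg _) fun _ _ => rieszFactor_le_one _

theorem rieszProd_add (a b : ℕ) (x : ℝ) :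
    rieszProd (a + b) x = rieszProd a x * rieszProd b (4 ^ a * x) := by
  rw [rieszProd, rieszProd, rieszProd, prod_range_add]
  congr 1
  refine prod_congr rfl fun i _ => ?_
  congr 1
  ring

theorem prod_range_two_mul {M : Type*} [CommMonoid M] (f : ℕ → M) (L : ℕ) :
    ∏ j ∈ range (2 * L), f j = ∏ i ∈ range L, (f (2 * i) * f (2 * i + 1)) := by
  induction L with
  | zero => simp
  | succ L ih => rw [mul_add, mul_one, prod_range_succ, prod_range_succ, ih, prod_range_succ,
      mul_assoc]

theorem WellSpaced.sum_rieszProd_le {ι : Type*} {s : Finset ι} {y : ι → ℝ} {L : ℕ}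
    (h : WellSpaced s y (4 ^ L)) :
    ∑ i ∈ s, rieszProd L (y i) ≤ 16 * 4 ^ L * (35 / 36) ^ L := by
  have h4 : (4 : ℕ) ^ L = 2 ^ (2 * L) := by rw [pow_mul]; norm_num
  have h4' : (4 : ℝ) ^ L = 2 ^ (2 * L) := by rw [pow_mul]; norm_num
  rw [h4] at h
  set r : ℝ := Real.sqrt (17 / 18) with hr
  have hr2 : r ^ 2 = 17 / 18 := Real.sq_sqrt (by norm_num)
  have key := h.sum_riesz_le (fun j => if j % 2 = 0 then (((1 + r) / 2 : ℝ) : ℂ) else 1)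
    (fun j => if j % 2 = 0 then (((1 - r) / 2 : ℝ) : ℂ) else 0)
  simp only [prod_range_two_mul] at key
  have e1 : ∀ i : ℕ, 2 * i % 2 = 0 := fun i => by omega
  have e2 : ∀ i : ℕ, ¬ (2 * i + 1) % 2 = 0 := fun i => by omega
  simp only [e1, e2, if_true, if_false, zero_mul, add_zero, norm_one, norm_zero, one_pow,
    mul_one, ne_eq, OfNat.ofNat_ne_zero, not_false_eq_true, zero_pow, normSq_add_mul_unitExp,
    Complex.norm_real, Real.norm_eq_abs, sq_abs] at key
  have e3 : ((1 + r) / 2) ^ 2 + ((1 - r) / 2) ^ 2 = 35 / 36 := by nlinarith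
  have e4 : 2 * ((1 + r) / 2) * ((1 - r) / 2) = 1 / 36 := by nlinarith
  rw [e3, e4, prod_const, card_range] at key
  rw [h4']
  refine le_trans (le_of_eq ?_) key
  refine sum_congr rfl fun i _ => ?_
  rw [rieszProd]
  refine prod_congr rfl fun j _ => ?_
  rw [rieszFactor, Real.sin_sq_eq_half_sub, pow_mul]
  norm_num
  ring_nf

theorem two_mul_abs_sin_le {y : ℝ} (h : Real.sin y ^ 2 ≤ 1 / 8) :
    2 * |Real.sin y| ≤ |Real.sin (4 * y)| := by
  have e : Real.sin (4 * y) = Real.sin y * (4 * (Real.cos y * Real.cos (2 * y))) := by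
    rw [show 4 * y = 2 * (2 * y) by ring, Real.sin_two_mul, Real.sin_two_mul]; ring
  rw [e, abs_mul, mul_comm]
  refine mul_le_mul_of_nonneg_left ?_ (abs_nonneg _)
  refine abs_le_of_sq_le_sq' ?_ (abs_nonneg _) |>.2
  rw [sq_abs, mul_pow, mul_pow, Real.cos_two_mul, Real.cos_sq']
  nlinarith [sq_nonneg (Real.sin y)]

theorem rieszProd_le_of_lt {w : ℕ} {x : ℝ} (h : 1 < 2 ^ w * |Real.sin (Real.pi * x)|) :
    rieszProd w x ≤ 143 / 144 := by
  have hex : ∃ i ∈ range w, 1 / 8 < Real.sin (Real.pi * (4 ^ i * x)) ^ 2 := by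
    by_contra hcon
    push Not at hcon
    have : ∀ v ≤ w, 2 ^ v * |Real.sin (Real.pi * x)| ≤ |Real.sin (Real.pi * (4 ^ v * x))| := by
      intro v
      induction v with
      | zero => intro _; simp
      | succ v ih =>
        intro hv
        have h1 := ih (by omega)
        have h2 := two_mul_abs_sin_le (hcon v (mem_range.2 (by omega)))
        have e : 4 * (Real.pi * (4 ^ v * x)) = Real.pi * (4 ^ (v + 1) * x) := by ring
        rw [e] at h2
        rw [pow_succ]
        linarith
    have h1 := this w le_rfl
    have h2 := Real.abs_sin_le_one (Real.pi * (4 ^ w * x))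
    linarith
  obtain ⟨i, hi, hi2⟩ := hex
  rw [rieszProd, ← mul_prod_erase _ _ hi]
  have h1 : ∏ j ∈ (range w).erase i, rieszFactor (4 ^ j * x) ≤ 1 :=
    prod_le_one (fun _ _ => rieszFactor_nonneg _) fun _ _ => rieszFactor_le_one _
  have h2 : rieszFactor (4 ^ i * x) ≤ 143 / 144 := by rw [rieszFactor]; linarith
  calc _ ≤ (143 / 144 : ℝ) * 1 := mul_le_mul h2 h1
        (prod_nonneg fun _ _ => rieszFactor_nonneg _) (by norm_num)
    _ = _ := mul_one _

theorem rieszProd_mul_le {w : ℕ} (v : ℕ) {x : ℝ}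
    (h : ∀ i : ℕ, 1 < 2 ^ w * |Real.sin (Real.pi * (4 ^ i * x))|) :
    rieszProd (w * v) x ≤ (143 / 144) ^ v := by
  induction v generalizing x with
  | zero => simp [rieszProd]
  | succ v ih =>
    rw [mul_add, mul_one, add_comm, rieszProd_add, pow_succ, mul_comm]
    refine mul_le_mul (ih fun i => ?_) (rieszProd_le_of_lt (by simpa using h 0))
      (rieszProd_nonneg _ _) (by positivity)
    have := h (i + w)
    rwa [pow_add, mul_assoc] at this

theorem rieszProd_le_mul_pow {w m : ℕ} (hw : 0 < w) (hwm : w ≤ m) {x : ℝ}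
    (h : ∀ i : ℕ, 1 < 2 ^ w * |Real.sin (Real.pi * (4 ^ i * x))|) :
    rieszProd m x ≤ rieszProd w x * (143 / 144) ^ (m / w - 1) := by
  have h1 : m = w + w * (m / w - 1) + m % w := by
    have h2 : 1 ≤ m / w := (Nat.one_le_div_iff hw).2 hwm
    obtain ⟨d, hd⟩ := Nat.exists_eq_add_of_le h2
    have h3 := Nat.div_add_mod m w
    rw [hd] at h3 ⊢
    rw [Nat.add_sub_cancel_left]
    linarith [mul_add w 1 d]
  conv_lhs => rw [h1]
  rw [rieszProd_add, rieszProd_add]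
  refine (mul_le_of_le_one_right (mul_nonneg (rieszProd_nonneg _ _) (rieszProd_nonneg _ _))
    (rieszProd_le_one _ _)).trans ?_
  refine mul_le_mul_of_nonneg_left (rieszProd_mul_le _ fun i => ?_) (rieszProd_nonneg _ _)
  have := h (i + w)
  rwa [pow_add, mul_assoc] at this

/-- The part of `∏_{j < n} |cos π(x 2 ^ j + y 2 ^ (n - 1 - j))|` with `j < m`. -/
noncomputable def cosProd (n m : ℕ) (x y : ℝ) : ℝ :=
  ∏ j ∈ range m, |Real.cos (Real.pi * (x * 2 ^ j + y * 2 ^ (n - 1 - j)))|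

theorem cosProd_nonneg (n m : ℕ) (x y : ℝ) : 0 ≤ cosProd n m x y :=
  prod_nonneg fun _ _ => abs_nonneg _

theorem norm_sum_unitExp_add_binaryReversal (n : ℕ) (x y : ℝ) :
    ‖∑ k ∈ range (2 ^ n), unitExp (x * k + y * binaryReversal n k)‖ =
      2 ^ n * cosProd n n x y := by
  rw [sum_unitExp_add_binaryReversal, norm_prod, cosProd]
  simp only [norm_one_add_unitExp]
  rw [prod_mul_distrib, prod_const, card_range]

theorem WellSpaced.sum_cosProd_sq_le {ι : Type*} {s : Finset ι} {x : ι → ℝ} {m : ℕ}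
    (h : WellSpaced s x (2 ^ m)) (n : ℕ) (y : ℝ) :
    ∑ i ∈ s, cosProd n m (x i) y ^ 2 ≤ 16 := by
  have key := h.sum_riesz_le (fun _ => 1) (fun j => unitExp (y * 2 ^ (n - 1 - j)))
  simp only [norm_one, norm_unitExp, one_pow, prod_const, card_range, ← unitExp_add,
    norm_one_add_unitExp, mul_pow] at key
  have e : ∀ i, ∏ j ∈ range m, ((2 : ℝ) ^ 2 *
      |Real.cos (Real.pi * (y * 2 ^ (n - 1 - j) + 2 ^ j * x i))| ^ 2) =
      4 ^ m * cosProd n m (x i) y ^ 2 := by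
    intro i
    rw [prod_mul_distrib, prod_const, card_range, cosProd, prod_pow]
    norm_num
    congr 1
    refine prod_congr rfl fun j _ => ?_
    congr 3
    ring
  simp only [e, ← mul_sum] at key
  have h4 : (0 : ℝ) < 4 ^ m := by positivity
  refine le_of_mul_le_mul_left (key.trans (le_of_eq ?_)) h4
  rw [mul_assoc, ← mul_pow]
  norm_num
  ring

theorem prod_Ico_abs_cos_le_rieszProd_left {n m : ℕ} (h : 4 * m ≤ n) (x y : ℝ) :
    ∏ j ∈ range (2 * m), |Real.cos (Real.pi * (x * 2 ^ (m + j) + y * 2 ^ (n - 1 - (m + j))))| ≤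
      rieszProd m (3 * 2 ^ m * x) := by
  rw [prod_range_two_mul, rieszProd]
  refine prod_le_prod (fun _ _ => by positivity) fun i hi => ?_
  have hi := mem_range.1 hi
  refine (abs_cos_mul_cos_le _ _).trans (le_of_eq ?_)
  congr 1
  have e : n - 1 - (m + 2 * i) = n - 1 - (m + (2 * i + 1)) + 1 := by omega
  rw [e, show (4 : ℝ) = 2 ^ 2 by norm_num, ← pow_mul, ← add_assoc, pow_succ, pow_succ, pow_add]
  ring

theorem prod_Ico_abs_cos_le_rieszProd_right {n m : ℕ} (h : 4 * m ≤ n) (x y : ℝ) :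
    ∏ j ∈ range (2 * m), |Real.cos (Real.pi * (x * 2 ^ (m + j) + y * 2 ^ (n - 1 - (m + j))))| ≤
      rieszProd m (3 * 2 ^ (n - 3 * m) * y) := by
  rw [prod_range_two_mul, rieszProd, ← prod_range_reflect]
  refine prod_le_prod (fun _ _ => by positivity) fun i hi => ?_
  have hi := mem_range.1 hi
  rw [mul_comm |_|]
  refine (abs_cos_mul_cos_le _ _).trans (le_of_eq ?_)
  congr 1
  have e : n - 1 - (m + 2 * (m - 1 - i)) = n - 3 * m + 2 * i + 1 := by omega
  have e' : n - 1 - (m + (2 * (m - 1 - i) + 1)) = n - 3 * m + 2 * i := by omega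
  rw [e, e', show (4 : ℝ) = 2 ^ 2 by norm_num, ← pow_mul, ← add_assoc, pow_succ, pow_succ, pow_add]
  ring

theorem exists_cosProd_le {n m : ℕ} (h : 4 * m ≤ n) (x y : ℝ) :
    ∃ M : ℝ, 0 ≤ M ∧ M ≤ rieszProd m (3 * 2 ^ m * x) ∧ M ≤ rieszProd m (3 * 2 ^ (n - 3 * m) * y) ∧
      cosProd n n x y ≤ cosProd n m x y * cosProd n m y x * M := by
  refine ⟨∏ j ∈ range (2 * m),
    |Real.cos (Real.pi * (x * 2 ^ (m + j) + y * 2 ^ (n - 1 - (m + j))))|,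
    prod_nonneg fun _ _ => abs_nonneg _, prod_Ico_abs_cos_le_rieszProd_left h x y,
    prod_Ico_abs_cos_le_rieszProd_right h x y, ?_⟩
  obtain ⟨d, rfl⟩ := Nat.exists_eq_add_of_le h
  set n := 4 * m + d with hn
  have e : n = m + 2 * m + d + m := by omega
  have hsplit : cosProd n n x y = ∏ j ∈ range (m + 2 * m + d + m),
      |Real.cos (Real.pi * (x * 2 ^ j + y * 2 ^ (n - 1 - j)))| := by rw [cosProd, ← e]
  rw [hsplit, prod_range_add, prod_range_add, prod_range_add]
  have hlast : ∏ j ∈ range m, |Real.cos (Real.pi * (x * 2 ^ (m + 2 * m + d + j) +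
      y * 2 ^ (n - 1 - (m + 2 * m + d + j))))| = cosProd n m y x := by
    rw [← prod_range_reflect, cosProd]
    refine prod_congr rfl fun j hj => ?_
    have hj := mem_range.1 hj
    have e1 : m + 2 * m + d + (m - 1 - j) = n - 1 - j := by omega
    have e2 : n - 1 - (n - 1 - j) = j := by omega
    rw [e1, e2, add_comm]
  rw [hlast]
  have hd : ∏ j ∈ range d, |Real.cos (Real.pi * (x * 2 ^ (m + 2 * m + j) +
      y * 2 ^ (n - 1 - (m + 2 * m + j))))| ≤ 1 :=
    prod_le_one (fun _ _ => abs_nonneg _) fun _ _ => Real.abs_cos_le_one _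
  have hA := cosProd_nonneg n m x y
  have hA' := cosProd_nonneg n m y x
  have hM : 0 ≤ ∏ j ∈ range (2 * m),
    |Real.cos (Real.pi * (x * 2 ^ (m + j) + y * 2 ^ (n - 1 - (m + j))))| :=
    prod_nonneg fun _ _ => abs_nonneg _
  rw [← cosProd, mul_right_comm _ (cosProd n m y x)]
  exact mul_le_mul_of_nonneg_right (mul_le_of_le_one_right (mul_nonneg hA hM) hd) hA'

theorem sum_nthRootsFinset_one {n : ℕ} (hn : 1 < n) :
    ∑ z ∈ Polynomial.nthRootsFinset n (1 : ℂ), z = 0 := by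
  have hn0 : 0 < n := by omega
  have hζ := Complex.isPrimitiveRoot_exp n hn0.ne'
  set ζ := Complex.exp (2 * Real.pi * Complex.I / n)
  have h1 : ∑ z ∈ Polynomial.nthRootsFinset n (1 : ℂ), z =
      ∑ z ∈ Polynomial.nthRootsFinset n (1 : ℂ), ζ * z := by
    symm
    refine sum_nbij' (fun z => ζ * z) (fun z => ζ⁻¹ * z) ?_ ?_ ?_ ?_ ?_
    · intro z hz
      rw [Polynomial.mem_nthRootsFinset hn0] at hz ⊢
      rw [mul_pow, hζ.pow_eq_one, hz, mul_one]
    · intro z hz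
      rw [Polynomial.mem_nthRootsFinset hn0] at hz ⊢
      rw [mul_pow, inv_pow, hζ.pow_eq_one, hz, inv_one, mul_one]
    · intro z _
      exact inv_mul_cancel_left₀ (hζ.ne_zero hn0.ne') z
    · intro z _
      exact mul_inv_cancel_left₀ (hζ.ne_zero hn0.ne') z
    · intro z _
      rfl
  rw [← mul_sum] at h1
  have h2 : (1 - ζ) * ∑ z ∈ Polynomial.nthRootsFinset n (1 : ℂ), z = 0 := by
    rw [sub_mul, one_mul, ← h1, sub_self]
  rcases mul_eq_zero.1 h2 with h | h
  · exact absurd (sub_eq_zero.1 h).symm (hζ.ne_one hn)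
  · exact h

/-- The sum of the primitive `n`-th roots of unity is `μ(n)`. -/
theorem sum_primitiveRoots_eq_moebius {n : ℕ} (hn : 0 < n) :
    ∑ z ∈ primitiveRoots n ℂ, z = ArithmeticFunction.moebius n := by
  classical
  have key : ∀ n > 0, ∑ d ∈ n.divisors, ∑ z ∈ primitiveRoots d ℂ, z =
      if n = 1 then (1 : ℂ) else 0 := by
    intro n hn
    rw [← sum_biUnion, ← IsPrimitiveRoot.nthRoots_one_eq_biUnion_primitiveRoots]
    · split_ifs with h
      · rw [h, show Polynomial.nthRootsFinset 1 (1 : ℂ) = {1} by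
          ext z; simp [Polynomial.mem_nthRootsFinset], sum_singleton]
      · exact sum_nthRootsFinset_one (by omega)
    · intro a _ b _ hab
      exact IsPrimitiveRoot.disjoint hab
  have := ArithmeticFunction.sum_eq_iff_sum_mul_moebius_eq.1 key n hn
  rw [← this, sum_eq_single (n, 1)]
  · simp
  · rintro ⟨a, b⟩ hab hne
    have : b ≠ 1 := by
      rintro rfl
      rw [Nat.mem_divisorsAntidiagonal, mul_one] at hab
      exact hne (Prod.ext hab.1 rfl)
    simp [this]
  · intro h
    simp [Nat.mem_divisorsAntidiagonal] at h
    omega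

/-- The Ramanujan sum `c_q(k)` equals `μ(q)` when `k` is coprime to `q`. -/
theorem sum_coprime_unitExp {q k : ℕ} (hq : 0 < q) (hk : k.Coprime q) :
    ∑ a ∈ range q with q.Coprime a, unitExp ((a : ℝ) / q * k) = ArithmeticFunction.moebius q := by
  have hζ := Complex.isPrimitiveRoot_exp_of_coprime k q hq.ne' hk
  have : NeZero q := ⟨hq.ne'⟩
  rw [← sum_primitiveRoots_eq_moebius hq]
  set ζ := Complex.exp (2 * Real.pi * Complex.I * (k / q)) with hz
  have e : ∀ a : ℕ, unitExp ((a : ℝ) / q * k) = ζ ^ a := by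
    intro a
    rw [hz, unitExp, ← Complex.exp_nat_mul]
    congr 1
    push_cast
    ring
  simp only [e]
  refine sum_nbij (fun a => ζ ^ a) ?_ ?_ ?_ fun _ _ => rfl
  · intro a ha
    rw [mem_filter, mem_range] at ha
    rw [mem_primitiveRoots hq]
    exact hζ.pow_of_coprime a ha.2.symm
  · intro a ha b hb hab
    rw [mem_coe, mem_filter, mem_range] at ha hb
    exact hζ.pow_inj ha.1 hb.1 hab
  · intro z hz
    rw [mem_coe, mem_primitiveRoots hq, hζ.isPrimitiveRoot_iff] at hz
    obtain ⟨i, hi, hc, rfl⟩ := hz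
    exact ⟨i, by rw [mem_coe, mem_filter, mem_range]; exact ⟨hi, hc.symm⟩, rfl⟩

/-- The reduced fractions in `[0, 1)` with denominator in `A`. -/
noncomputable def fareySet (A : Finset ℕ) : Finset ℚ :=
  A.biUnion fun q => ((range q).filter q.Coprime).image fun a : ℕ => (a : ℚ) / q

theorem den_natCast_div {a q : ℕ} (hq : 0 < q) (h : q.Coprime a) : ((a : ℚ) / q).den = q := by
  have := Rat.den_div_eq_of_coprime (a := a) (b := q) (by exact_mod_cast hq) (by simpa using h.symm)
  rw [Int.cast_natCast, Int.cast_natCast] at this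
  exact Nat.cast_injective this

theorem mem_fareySet {A : Finset ℕ} {x : ℚ} : x ∈ fareySet A ↔ 0 ≤ x ∧ x < 1 ∧ x.den ∈ A := by
  simp only [fareySet, mem_biUnion, mem_image, mem_filter, mem_range]
  constructor
  · rintro ⟨q, hq, a, ⟨ha, hc⟩, rfl⟩
    have hq0 : 0 < q := by omega
    refine ⟨by positivity, ?_, by rwa [den_natCast_div hq0 hc]⟩
    rw [div_lt_one (by exact_mod_cast hq0)]
    exact_mod_cast ha
  · rintro ⟨h0, h1, hd⟩
    have hn : ((x.num.natAbs : ℕ) : ℤ) = x.num := Int.natAbs_of_nonneg (Rat.num_nonneg.2 h0)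
    have e : ((x.num.natAbs : ℕ) : ℚ) / x.den = x := by
      have : ((x.num.natAbs : ℕ) : ℚ) = (x.num : ℚ) := by
        rw [← Int.cast_natCast, hn]
      rw [this, Rat.num_div_den]
    refine ⟨x.den, hd, x.num.natAbs, ⟨?_, x.reduced.symm⟩, e⟩
    have hpos : (0 : ℚ) < x.den := by exact_mod_cast x.den_pos
    rw [← e, div_lt_one hpos] at h1
    exact_mod_cast h1

theorem sum_fareySet {M : Type*} [AddCommMonoid M] (A : Finset ℕ) (g : ℚ → M) :
    ∑ x ∈ fareySet A, g x = ∑ q ∈ A, ∑ a ∈ range q with q.Coprime a, g ((a : ℚ) / q) := by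
  rw [fareySet, sum_biUnion]
  · refine sum_congr rfl fun q _ => sum_image ?_
    intro a ha b hb hab
    simp only [coe_filter, mem_range, Set.mem_ofPred_eq] at ha hb
    have hq0 : (q : ℚ) ≠ 0 := by
      have : q ≠ 0 := by omega
      exact_mod_cast this
    have := (div_left_inj' hq0).1 hab
    exact_mod_cast this
  · intro p _ q _ hpq
    rw [Function.onFun, disjoint_left]
    intro x hx hx'
    simp only [mem_image, mem_filter, mem_range] at hx hx'
    obtain ⟨a, ⟨ha, hc⟩, rfl⟩ := hx
    obtain ⟨b, ⟨hb, hc'⟩, hab⟩ := hx'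
    apply hpq
    rw [← den_natCast_div (by omega : 0 < p) hc, ← hab, den_natCast_div (by omega) hc']

theorem den_dvd_iff {t : ℚ} {n : ℕ} : t.den ∣ n ↔ ∃ z : ℤ, (n : ℚ) * t = z := by
  have hd : (t.den : ℚ) ≠ 0 := by exact_mod_cast t.den_nz
  constructor
  · rintro ⟨c, rfl⟩
    refine ⟨c * t.num, ?_⟩
    push_cast
    have := Rat.den_mul_eq_num t
    linear_combination (c : ℚ) * this
  · rintro ⟨z, hz⟩
    have h1 : (n : ℤ) * t.num = t.den * z := by
      have h2 : (n : ℚ) * t.num = t.den * z := by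
        rw [← Rat.den_mul_eq_num t, ← hz]
        ring
      exact_mod_cast h2
    have h3 : (t.den : ℤ) ∣ n * t.num := ⟨z, h1⟩
    have h4 : IsCoprime (t.den : ℤ) t.num := by
      rw [Int.isCoprime_iff_nat_coprime]
      simpa using t.reduced.symm
    exact_mod_cast h4.dvd_of_dvd_mul_right h3

theorem den_eq_one_of_abs_lt {t : ℚ} {n : ℕ} (h : t.den ∣ n) (hlt : n * |t| < 1) (hn : 0 < n) :
    t = 0 := by
  obtain ⟨z, hz⟩ := den_dvd_iff.1 h
  have h1 : |(z : ℚ)| < 1 := by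
    rw [← hz, abs_mul, Nat.abs_cast]
    exact hlt
  have h2 : |z| < 1 := by exact_mod_cast h1
  rw [Int.abs_lt_one_iff] at h2
  rw [h2] at hz
  have : (n : ℚ) ≠ 0 := by exact_mod_cast hn.ne'
  simpa [this] using hz

theorem one_div_le_abs_of_den_dvd {t : ℚ} {n : ℕ} (h : t.den ∣ n) (hn : 0 < n) (ht : t ≠ 0) :
    1 / (n : ℝ) ≤ |(t : ℝ)| := by
  by_contra hcon
  push Not at hcon
  refine ht (den_eq_one_of_abs_lt h ?_ hn)
  rw [lt_div_iff₀ (by exact_mod_cast hn)] at hcon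
  have : ((n * |t| : ℚ) : ℝ) < 1 := by push_cast; linarith
  exact_mod_cast this

theorem card_fract_sub_eq_le (A : Finset ℕ) (z : ℚ) {q r : ℕ} (hq : 0 < q) :
    #{p ∈ fareySet A ×ˢ fareySet A | Int.fract (p.1 - p.2) = z ∧ (p.1.den, p.2.den) = (q, r)} ≤
      q.gcd r := by
  have hg : 0 < q.gcd r := Nat.gcd_pos_of_pos_left _ hq
  rw [← card_range (q.gcd r)]
  refine card_le_card_of_injOn (fun p => ⌊(q.gcd r : ℚ) * p.1⌋₊) ?_ ?_
  · rintro ⟨x, y⟩ hp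
    simp only [coe_filter, mem_product, mem_fareySet, Set.mem_ofPred_eq] at hp
    simp only [coe_range, Set.mem_Iio]
    have hg' : (0 : ℚ) < q.gcd r := by exact_mod_cast hg
    rw [Nat.floor_lt (mul_nonneg hg'.le hp.1.1.1)]
    nlinarith [hp.1.1.2.1]
  · rintro ⟨x, y⟩ hp ⟨x', y'⟩ hp' hxx
    simp only [coe_filter, mem_product, mem_fareySet, Set.mem_ofPred_eq, Prod.mk.injEq] at hp hp'
    obtain ⟨⟨⟨hx0, hx1, -⟩, ⟨hy0, hy1, -⟩⟩, hz, rfl, rfl⟩ := hp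
    obtain ⟨⟨⟨hx0', hx1', -⟩, ⟨hy0', hy1', -⟩⟩, hz', hq', hr'⟩ := hp'
    simp only at *
    have hyy : (x - x') = (y - y') + ((⌊x - y⌋ - ⌊x' - y'⌋ : ℤ) : ℚ) := by
      have h1 := Int.fract_add_floor (x - y)
      have h2 := Int.fract_add_floor (x' - y')
      push_cast
      linarith
    have hd1 : (x - x').den ∣ x.den := by
      have := Rat.sub_den_dvd_lcm x x'
      rwa [hq', Nat.lcm_self] at this
    have hd2 : (x - x').den ∣ y.den := by
      have := Rat.sub_den_dvd_lcm y y'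
      rw [hr', Nat.lcm_self] at this
      rwa [hyy, Rat.add_intCast_den]
    have hd := Nat.dvd_gcd hd1 hd2
    have hg' : (0 : ℚ) < x.den.gcd y.den := by exact_mod_cast hg
    have hx : x - x' = 0 := by
      refine den_eq_one_of_abs_lt hd ?_ hg
      have a1 := Nat.floor_le (mul_nonneg hg'.le hx0)
      have a2 := Nat.lt_floor_add_one ((x.den.gcd y.den : ℚ) * x)
      have b1 := Nat.floor_le (mul_nonneg hg'.le hx0')
      have b2 := Nat.lt_floor_add_one ((x.den.gcd y.den : ℚ) * x')
      rw [hxx] at a1 a2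
      rw [← abs_of_pos hg', ← abs_mul, abs_lt]
      constructor <;> linarith
    have hy : y - y' = 0 := by
      rw [hx] at hyy
      have h1 : y - y' = ((-(⌊x - y⌋ - ⌊x' - y'⌋) : ℤ) : ℚ) := by push_cast at hyy ⊢; linarith
      have h2 : |((-(⌊x - y⌋ - ⌊x' - y'⌋) : ℤ) : ℚ)| < 1 := by
        rw [← h1, abs_lt]; constructor <;> linarith
      have h3 : |(-(⌊x - y⌋ - ⌊x' - y'⌋) : ℤ)| < 1 := by exact_mod_cast h2
      rw [Int.abs_lt_one_iff] at h3
      rw [h1, h3]; simp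
    rw [Prod.mk.injEq]
    exact ⟨sub_eq_zero.1 hx, sub_eq_zero.1 hy⟩

theorem den_dvd_lcm_of_fract_sub_eq {x y z : ℚ} (h : Int.fract (x - y) = z) :
    z.den ∣ x.den.lcm y.den := by
  rw [← h, Rat.den_intFract]
  exact Rat.sub_den_dvd_lcm x y

/-- The Fourier coefficient `μ(q) / q` of the sieve weight at a fraction of denominator `q`. -/
noncomputable def sieveCoeff (x : ℚ) : ℝ := ArithmeticFunction.moebius x.den / x.den

/-- The (unnormalised) sieve weight `∑_{q ∈ A} μ(q) / q ∑_{a mod q}^* exp (2πi ak / q)`. -/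
noncomputable def sieveWeight (A : Finset ℕ) (k : ℕ) : ℂ :=
  ∑ x ∈ fareySet A, sieveCoeff x * unitExp (x * k)

/-- The fractional parts of differences of elements of `fareySet A`. -/
noncomputable def diffSet (A : Finset ℕ) : Finset ℚ :=
  (fareySet A ×ˢ fareySet A).image fun p => Int.fract (p.1 - p.2)

/-- The Fourier coefficients of the square of the sieve weight. -/
noncomputable def autocorr (A : Finset ℕ) (z : ℚ) : ℝ :=
  ∑ p ∈ fareySet A ×ˢ fareySet A with Int.fract (p.1 - p.2) = z, sieveCoeff p.1 * sieveCoeff p.2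

theorem unitExp_fract_mul (x : ℚ) (k : ℕ) :
    unitExp ((Int.fract x : ℚ) * k) = unitExp (x * k) := by
  have : (x : ℝ) * k = (Int.fract x : ℚ) * k + ((⌊x⌋ * k : ℤ) : ℝ) := by
    have h : (x : ℝ) = (Int.fract x : ℚ) + (⌊x⌋ : ℤ) := by
      exact_mod_cast congrArg (Rat.cast : ℚ → ℝ) (Int.fract_add_floor x).symm
    conv_lhs => rw [h]
    push_cast
    ring
  rw [this, unitExp_add_intCast]

theorem norm_sq_sieveWeight (A : Finset ℕ) (k : ℕ) :
    ((‖sieveWeight A k‖ ^ 2 : ℝ) : ℂ) =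
      ∑ z ∈ diffSet A, autocorr A z * unitExp (z * k) := by
  push_cast
  rw [← Complex.mul_conj', sieveWeight, map_sum, sum_mul_sum, ← sum_product',
    ← sum_fiberwise_of_maps_to (t := diffSet A) (g := fun p => Int.fract (p.1 - p.2))]
  · refine sum_congr rfl fun z _ => ?_
    rw [autocorr, Complex.ofReal_sum, sum_mul]
    refine sum_congr rfl fun p hp => ?_
    rw [← (mem_filter.1 hp).2, unitExp_fract_mul, map_mul, conj_unitExp, Complex.conj_ofReal,
      mul_mul_mul_comm, ← unitExp_add]
    push_cast
    congr 2
    ring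
  · intro p hp
    exact mem_image_of_mem _ hp

theorem sieveWeight_of_coprime {A : Finset ℕ} (hA : ∀ q ∈ A, 0 < q ∧ Squarefree q) {k : ℕ}
    (hk : ∀ q ∈ A, k.Coprime q) : sieveWeight A k = ((∑ q ∈ A, 1 / (q : ℝ) : ℝ) : ℂ) := by
  rw [sieveWeight, sum_fareySet, Complex.ofReal_sum]
  refine sum_congr rfl fun q hq => ?_
  obtain ⟨hq0, hqs⟩ := hA q hq
  have h1 : ∀ a ∈ (range q).filter q.Coprime,
      (sieveCoeff ((a : ℚ) / q) : ℂ) * unitExp (((a : ℚ) / q : ℚ) * k) =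
        (((ArithmeticFunction.moebius q : ℝ) / q : ℝ) : ℂ) * unitExp ((a : ℝ) / q * k) := by
    intro a ha
    rw [sieveCoeff, den_natCast_div hq0 (mem_filter.1 ha).2]
    push_cast
    rfl
  rw [sum_congr rfl h1, ← mul_sum, sum_coprime_unitExp hq0 (hk q hq)]
  have h2 : (ArithmeticFunction.moebius q : ℂ) * ArithmeticFunction.moebius q = 1 := by
    have := ArithmeticFunction.moebius_sq_eq_one_of_squarefree hqs
    rw [sq] at this
    exact_mod_cast congrArg (Int.cast : ℤ → ℂ) this
  push_cast
  rw [div_mul_eq_mul_div, h2]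

theorem abs_sieveCoeff_le (x : ℚ) : |sieveCoeff x| ≤ 1 / x.den := by
  rw [sieveCoeff, abs_div, Nat.abs_cast]
  refine div_le_div_of_nonneg_right ?_ (Nat.cast_nonneg _)
  have := ArithmeticFunction.abs_moebius_le_one (n := x.den)
  exact_mod_cast this

theorem autocorr_zero_le (A : Finset ℕ) : |autocorr A 0| ≤ ∑ q ∈ A, 1 / (q : ℝ) := by
  have h1 : autocorr A 0 = ∑ x ∈ fareySet A, sieveCoeff x ^ 2 := by
    have h2 : ({p ∈ fareySet A ×ˢ fareySet A | Int.fract (p.1 - p.2) = 0}) =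
        (fareySet A).diag := by
      ext ⟨x, y⟩
      simp only [mem_filter, mem_product, mem_diag, mem_fareySet]
      constructor
      · rintro ⟨⟨hx, hy⟩, h⟩
        refine ⟨hx, ?_⟩
        rw [Int.fract_eq_zero_iff] at h
        obtain ⟨z, hz⟩ := h
        have h3 : |(z : ℚ)| < 1 := by
          rw [hz, abs_lt]; constructor <;> linarith [hx.1, hx.2.1, hy.1, hy.2.1]
        have h4 : |z| < 1 := by exact_mod_cast h3
        rw [Int.abs_lt_one_iff] at h4
        rw [h4] at hz
        simp only [Int.cast_zero] at hz
        linarith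
      · rintro ⟨hx, rfl⟩
        simp [hx]
    rw [autocorr, h2, sum_diag]
    exact sum_congr rfl fun _ _ => (sq _).symm
  rw [h1, abs_of_nonneg (sum_nonneg fun _ _ => sq_nonneg _), sum_fareySet]
  refine sum_le_sum fun q _ => ?_
  rcases Nat.eq_zero_or_pos q with rfl | hq0
  · simp
  have hq : (0 : ℝ) < q := by exact_mod_cast hq0
  calc ∑ a ∈ range q with q.Coprime a, sieveCoeff ((a : ℚ) / q) ^ 2
      ≤ ∑ a ∈ range q with q.Coprime a, (1 / (q : ℝ)) ^ 2 := by
        refine sum_le_sum fun a ha => ?_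
        have := abs_sieveCoeff_le ((a : ℚ) / q)
        rw [den_natCast_div hq0 (mem_filter.1 ha).2] at this
        rw [← sq_abs]
        exact pow_le_pow_left₀ (abs_nonneg _) this 2
    _ ≤ ∑ a ∈ range q, (1 / (q : ℝ)) ^ 2 :=
        sum_le_sum_of_subset_of_nonneg (filter_subset _ _) fun _ _ _ => by positivity
    _ = 1 / q := by
        rw [sum_const, card_range, nsmul_eq_mul]
        field_simp

/-- The harmonic sum `∑_{g ≤ Q} 1 / g`. -/
noncomputable def harmonicSum (Q : ℕ) : ℝ := ∑ g ∈ Icc 1 Q, 1 / (g : ℝ)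

theorem sum_gcd_div_le {q : ℕ} (hq : 0 < q) (Q : ℕ) :
    ∑ g ∈ Icc 1 Q, (q.gcd g : ℝ) / g ≤ #q.divisors * harmonicSum Q := by
  have h1 : ∀ g ∈ Icc 1 Q, (q.gcd g : ℝ) / g ≤
      ∑ x ∈ q.divisors, if x ∣ g then (x : ℝ) / g else 0 := by
    intro g _
    have hmem : q.gcd g ∈ q.divisors := Nat.mem_divisors.2 ⟨Nat.gcd_dvd_left _ _, hq.ne'⟩
    refine le_trans ?_ (single_le_sum (f := fun x : ℕ => if x ∣ g then (x : ℝ) / g else 0)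
      (fun x _ => by split_ifs <;> positivity) hmem)
    simp [Nat.gcd_dvd_right]
  refine (sum_le_sum h1).trans ?_
  rw [sum_comm, ← nsmul_eq_mul, ← sum_const]
  refine sum_le_sum fun x hx => ?_
  have hx0 : 0 < x := Nat.pos_of_mem_divisors hx
  rw [← sum_filter, harmonicSum]
  have h2 : ∀ g ∈ {g ∈ Icc 1 Q | x ∣ g}, (x : ℝ) / g = 1 / ((g / x : ℕ) : ℝ) := by
    intro g hg
    obtain ⟨d, rfl⟩ := (mem_filter.1 hg).2
    rw [Nat.mul_div_cancel_left _ hx0]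
    have : (x : ℝ) ≠ 0 := by exact_mod_cast hx0.ne'
    push_cast
    rw [div_mul_eq_div_div, div_self this]
  rw [sum_congr rfl h2, ← sum_image (f := fun d : ℕ => 1 / (d : ℝ)) (g := fun g => g / x)]
  · refine sum_le_sum_of_subset_of_nonneg ?_ fun _ _ _ => by positivity
    intro d hd
    simp only [mem_image, mem_filter, mem_Icc] at hd ⊢
    obtain ⟨g, ⟨⟨h1, h2⟩, d, rfl⟩, rfl⟩ := hd
    rw [Nat.mul_div_cancel_left _ hx0]
    exact ⟨Nat.pos_of_ne_zero (by rintro rfl; simp at h1),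
      (Nat.le_mul_of_pos_left d hx0).trans h2⟩
  · intro a ha b hb hab
    simp only [coe_filter, Set.mem_ofPred_eq] at ha hb hab
    exact Nat.div_left_inj ha.2 hb.2 |>.1 hab

theorem dvd_gcd_mul_gcd_mul_gcd {q g a b : ℕ} (h : q ∣ g * a * b) :
    q ∣ q.gcd g * q.gcd a * q.gcd b := by
  have h1 := Nat.gcd_mul_right_dvd_mul_gcd q (g * a) b
  have h2 := Nat.gcd_mul_right_dvd_mul_gcd q g a
  rw [Nat.gcd_eq_left h] at h1
  exact h1.trans (Nat.mul_dvd_mul_right h2 _)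

theorem gcd_div_mul_le {q q₁ q₂ : ℕ} (hq : 0 < q) (h₁ : 0 < q₁) (h₂ : 0 < q₂)
    (h : q ∣ q₁.lcm q₂) :
    (q₁.gcd q₂ : ℝ) / (q₁ * q₂) ≤ 1 / q * (((q.gcd (q₁.gcd q₂) : ℝ) / q₁.gcd q₂) *
      ((q.gcd (q₁ / q₁.gcd q₂) : ℝ) / (q₁ / q₁.gcd q₂ : ℕ)) *
      ((q.gcd (q₂ / q₁.gcd q₂) : ℝ) / (q₂ / q₁.gcd q₂ : ℕ))) := by
  have hg : 0 < q₁.gcd q₂ := Nat.gcd_pos_of_pos_left _ h₁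
  obtain ⟨a, ha⟩ := Nat.gcd_dvd_left q₁ q₂
  obtain ⟨b, hb⟩ := Nat.gcd_dvd_right q₁ q₂
  set g := q₁.gcd q₂ with hgdef
  have ha' : q₁ / g = a := Nat.div_eq_of_eq_mul_right hg ha
  have hb' : q₂ / g = b := Nat.div_eq_of_eq_mul_right hg hb
  rw [ha', hb']
  have ha0 : 0 < a := Nat.pos_of_ne_zero (by rintro rfl; omega)
  have hb0 : 0 < b := Nat.pos_of_ne_zero (by rintro rfl; omega)
  have hl : q₁.lcm q₂ = g * a * b := by
    rw [Nat.lcm, ← hgdef]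
    refine Nat.div_eq_of_eq_mul_right hg ?_
    conv_lhs => rw [ha, hb]
    ring
  rw [hl] at h
  have hle := Nat.le_of_dvd (Nat.mul_pos (Nat.mul_pos (Nat.gcd_pos_of_pos_left _ hq)
    (Nat.gcd_pos_of_pos_left _ hq)) (Nat.gcd_pos_of_pos_left _ hq)) (dvd_gcd_mul_gcd_mul_gcd h)
  have hle' : (q : ℝ) ≤ q.gcd g * q.gcd a * q.gcd b := by exact_mod_cast hle
  have e1 : (q₁ : ℝ) = g * a := by exact_mod_cast ha
  have e2 : (q₂ : ℝ) = g * b := by exact_mod_cast hb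
  have hg' : (0 : ℝ) < g := by exact_mod_cast hg
  have ha'' : (0 : ℝ) < a := by exact_mod_cast ha0
  have hb'' : (0 : ℝ) < b := by exact_mod_cast hb0
  have hq' : (0 : ℝ) < q := by exact_mod_cast hq
  rw [e1, e2]
  have : (1 : ℝ) / q * ((q.gcd g : ℝ) / g * ((q.gcd a : ℝ) / a) * ((q.gcd b : ℝ) / b)) =
      (q.gcd g * q.gcd a * q.gcd b) / q * (g / (g * a * (g * b))) := by
    field_simp
  rw [this]
  refine le_mul_of_one_le_left (by positivity) ?_
  rwa [one_le_div hq']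

theorem abs_autocorr_le {A : Finset ℕ} {Q : ℕ} (hA : A ⊆ Icc 1 Q) (z : ℚ) :
    |autocorr A z| ≤ (#z.den.divisors * harmonicSum Q) ^ 3 / z.den := by
  have hAp : ∀ q ∈ A, 0 < q := fun q hq => (mem_Icc.1 (hA hq)).1
  set ψ : ℕ → ℝ := fun g => (z.den.gcd g : ℝ) / g with hψ
  have hψ0 : ∀ g, 0 ≤ ψ g := fun g => by positivity
  set Z := {p ∈ fareySet A ×ˢ fareySet A | Int.fract (p.1 - p.2) = z} with hZ
  have hmaps : ∀ p ∈ Z, (p.1.den, p.2.den) ∈ A ×ˢ A := by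
    intro p hp
    rw [hZ, mem_filter, mem_product, mem_fareySet, mem_fareySet] at hp
    exact mem_product.2 ⟨hp.1.1.2.2, hp.1.2.2.2⟩
  have h1 : |autocorr A z| ≤ ∑ p ∈ Z, 1 / ((p.1.den : ℝ) * p.2.den) := by
    refine (abs_sum_le_sum_abs _ _).trans (sum_le_sum fun p _ => ?_)
    rw [abs_mul, ← one_div_mul_one_div]
    exact mul_le_mul (abs_sieveCoeff_le _) (abs_sieveCoeff_le _) (abs_nonneg _) (by positivity)
  have h2 : ∀ qq ∈ A ×ˢ A, ∑ p ∈ Z with (p.1.den, p.2.den) = qq, 1 / ((p.1.den : ℝ) * p.2.den) ≤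
      1 / z.den * (ψ (qq.1.gcd qq.2) * ψ (qq.1 / qq.1.gcd qq.2) * ψ (qq.2 / qq.1.gcd qq.2)) := by
    rintro ⟨q, r⟩ hqr
    rw [mem_product] at hqr
    have hq := hAp q hqr.1
    have hr := hAp r hqr.2
    have hconst : ∀ p ∈ {p ∈ Z | (p.1.den, p.2.den) = (q, r)},
        1 / ((p.1.den : ℝ) * p.2.den) = 1 / (q * r) := by
      intro p hp
      have := (mem_filter.1 hp).2
      rw [Prod.mk.injEq] at this
      rw [this.1, this.2]
    rw [sum_congr rfl hconst, sum_const, nsmul_eq_mul, mul_one_div]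
    rcases ({p ∈ Z | (p.1.den, p.2.den) = (q, r)}).eq_empty_or_nonempty with he | ⟨p, hp⟩
    · rw [he]
      simp only [card_empty, Nat.cast_zero, zero_div]
      have := hψ0 (q.gcd r)
      have := hψ0 (q / q.gcd r)
      have := hψ0 (r / q.gcd r)
      positivity
    · have hd : z.den ∣ q.lcm r := by
        rw [mem_filter, hZ, mem_filter, Prod.mk.injEq] at hp
        rw [← hp.2.1, ← hp.2.2]
        exact den_dvd_lcm_of_fract_sub_eq hp.1.2
      refine le_trans ?_ (gcd_div_mul_le z.den_pos hq hr hd)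
      refine div_le_div_of_nonneg_right ?_ (by positivity)
      rw [hZ, filter_filter]
      exact_mod_cast card_fract_sub_eq_le A z hq
  set φ : ℕ × ℕ → ℕ × ℕ × ℕ :=
    fun qq => (qq.1.gcd qq.2, qq.1 / qq.1.gcd qq.2, qq.2 / qq.1.gcd qq.2) with hφ
  have hinj : Set.InjOn φ (A ×ˢ A : Finset (ℕ × ℕ)) := by
    rintro ⟨a, b⟩ - ⟨c, d⟩ - h
    simp only [hφ, Prod.mk.injEq] at h
    obtain ⟨h1, h2, h3⟩ := h
    have ha := Nat.mul_div_cancel' (Nat.gcd_dvd_left a b)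
    have hb := Nat.mul_div_cancel' (Nat.gcd_dvd_right a b)
    rw [h2, h1, Nat.mul_div_cancel' (Nat.gcd_dvd_left c d)] at ha
    rw [h3, h1, Nat.mul_div_cancel' (Nat.gcd_dvd_right c d)] at hb
    rw [ha, hb]
  have hsub : (A ×ˢ A).image φ ⊆ Icc 1 Q ×ˢ Icc 1 Q ×ˢ Icc 1 Q := by
    intro t ht
    obtain ⟨⟨q, r⟩, hqr, rfl⟩ := mem_image.1 ht
    rw [mem_product] at hqr
    have hq := mem_Icc.1 (hA hqr.1)
    have hr := mem_Icc.1 (hA hqr.2)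
    have hg : 0 < q.gcd r := Nat.gcd_pos_of_pos_left _ hq.1
    simp only [hφ, mem_product, mem_Icc]
    exact ⟨⟨hg, (Nat.gcd_le_left _ hq.1).trans hq.2⟩,
      ⟨Nat.div_pos (Nat.gcd_le_left _ hq.1) hg, (Nat.div_le_self _ _).trans hq.2⟩,
      ⟨Nat.div_pos (Nat.gcd_le_right _ hr.1) hg, (Nat.div_le_self _ _).trans hr.2⟩⟩
  calc |autocorr A z| ≤ ∑ p ∈ Z, 1 / ((p.1.den : ℝ) * p.2.den) := h1
    _ = ∑ qq ∈ A ×ˢ A, ∑ p ∈ Z with (p.1.den, p.2.den) = qq, 1 / ((p.1.den : ℝ) * p.2.den) :=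
        (sum_fiberwise_of_maps_to hmaps _).symm
    _ ≤ ∑ qq ∈ A ×ˢ A, 1 / (z.den : ℝ) *
          (ψ (φ qq).1 * ψ (φ qq).2.1 * ψ (φ qq).2.2) := sum_le_sum h2
    _ = ∑ t ∈ (A ×ˢ A).image φ, 1 / (z.den : ℝ) * (ψ t.1 * ψ t.2.1 * ψ t.2.2) :=
        (sum_image (f := fun t : ℕ × ℕ × ℕ => 1 / (z.den : ℝ) * (ψ t.1 * ψ t.2.1 * ψ t.2.2))
          hinj).symm
    _ ≤ ∑ t ∈ Icc 1 Q ×ˢ Icc 1 Q ×ˢ Icc 1 Q,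
          1 / (z.den : ℝ) * (ψ t.1 * ψ t.2.1 * ψ t.2.2) := by
        refine sum_le_sum_of_subset_of_nonneg hsub fun t _ _ => ?_
        have := hψ0 t.1
        have := hψ0 t.2.1
        have := hψ0 t.2.2
        positivity
    _ = 1 / z.den * (∑ g ∈ Icc 1 Q, ψ g) ^ 3 := by
        rw [← mul_sum, sum_product]
        simp only [sum_product, mul_assoc, ← mul_sum, ← sum_mul]
        ring
    _ ≤ 1 / z.den * (#z.den.divisors * harmonicSum Q) ^ 3 :=
        mul_le_mul_of_nonneg_left (pow_le_pow_left₀ (sum_nonneg fun g _ => hψ0 g)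
          (sum_gcd_div_le z.den_pos Q) 3) (by positivity)
    _ = _ := by ring

theorem sum_norm_sq_sieveWeight_le (A : Finset ℕ) (n : ℕ) :
    ∑ k ∈ range (2 ^ n), ‖sieveWeight A k‖ ^ 2 * ‖sieveWeight A (binaryReversal n k)‖ ^ 2 ≤
      2 ^ n * ∑ z ∈ diffSet A, ∑ w ∈ diffSet A,
        |autocorr A z| * |autocorr A w| * cosProd n n z w := by
  have h0 : 0 ≤ ∑ k ∈ range (2 ^ n),
      ‖sieveWeight A k‖ ^ 2 * ‖sieveWeight A (binaryReversal n k)‖ ^ 2 :=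
    sum_nonneg fun _ _ => by positivity
  have e : ((∑ k ∈ range (2 ^ n),
      ‖sieveWeight A k‖ ^ 2 * ‖sieveWeight A (binaryReversal n k)‖ ^ 2 : ℝ) : ℂ) =
      ∑ z ∈ diffSet A, ∑ w ∈ diffSet A, (autocorr A z : ℂ) * autocorr A w *
        ∑ k ∈ range (2 ^ n), unitExp (z * k + w * binaryReversal n k) := by
    simp only [mul_sum]
    rw [Complex.ofReal_sum, sum_congr rfl fun z _ => sum_comm, sum_comm]
    refine sum_congr rfl fun k _ => ?_
    rw [Complex.ofReal_mul, norm_sq_sieveWeight, norm_sq_sieveWeight, sum_mul_sum]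
    refine sum_congr rfl fun z _ => sum_congr rfl fun w _ => ?_
    rw [unitExp_add]
    ring
  have h1 := congrArg norm e
  rw [Complex.norm_real, Real.norm_of_nonneg h0] at h1
  rw [h1, mul_sum]
  refine (norm_sum_le _ _).trans (sum_le_sum fun z _ => ?_)
  rw [mul_sum]
  refine (norm_sum_le _ _).trans (sum_le_sum fun w _ => ?_)
  rw [norm_mul, norm_mul, norm_sum_unitExp_add_binaryReversal, Complex.norm_real,
    Complex.norm_real, Real.norm_eq_abs, Real.norm_eq_abs]
  exact le_of_eq (by ring)

/-- The squarefree integers `q ≤ Q` all of whose prime factors are at least `P`. -/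
noncomputable def sieveModuli (P Q : ℕ) : Finset ℕ :=
  open Classical in {q ∈ Icc 1 Q | Squarefree q ∧ ∀ p : ℕ, p.Prime → p ∣ q → P ≤ p}

theorem mem_sieveModuli {P Q q : ℕ} : q ∈ sieveModuli P Q ↔
    (1 ≤ q ∧ q ≤ Q) ∧ Squarefree q ∧ ∀ p : ℕ, p.Prime → p ∣ q → P ≤ p := by
  simp [sieveModuli]

theorem sieveModuli_subset (P Q : ℕ) : sieveModuli P Q ⊆ Icc 1 Q := fun _ hq =>
  mem_Icc.2 (mem_sieveModuli.1 hq).1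

/-- The normalising sum `∑ 1 / q` over the sieve moduli. -/
noncomputable def sieveMass (P Q : ℕ) : ℝ := ∑ q ∈ sieveModuli P Q, 1 / (q : ℝ)

theorem one_le_sieveMass {P Q : ℕ} (hQ : 1 ≤ Q) : 1 ≤ sieveMass P Q := by
  have h1 : 1 ∈ sieveModuli P Q := mem_sieveModuli.2
    ⟨⟨le_rfl, hQ⟩, squarefree_one, fun p hp h => absurd (Nat.dvd_one.1 h) hp.ne_one⟩
  refine le_trans ?_ (single_le_sum (f := fun q : ℕ => 1 / (q : ℝ))
    (fun _ _ => by positivity) h1)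
  simp

theorem sum_one_div_modEq_one_le (P Q : ℕ) :
    ∑ k ∈ Icc 1 Q with k % P.factorial = 1 % P.factorial, 1 / (k : ℝ) ≤ 2 * sieveMass P Q := by
  have hex : ∀ k : ℕ, ∃ p : ℕ × ℕ, p.2 ^ 2 * p.1 = k ∧ Squarefree p.1 := fun k => by
    obtain ⟨a, b, h⟩ := Nat.sq_mul_squarefree k
    exact ⟨(a, b), h⟩
  choose f hf1 hf2 using hex
  have hinj : Function.Injective f := fun k l h => by rw [← hf1 k, ← hf1 l, h]
  set K := {k ∈ Icc 1 Q | k % P.factorial = 1 % P.factorial} with hK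
  have hsub : K.image f ⊆ sieveModuli P Q ×ˢ Icc 1 Q := by
    intro p hp
    obtain ⟨k, hk, rfl⟩ := mem_image.1 hp
    rw [hK, mem_filter, mem_Icc] at hk
    have hk0 : 0 < k := hk.1.1
    have hd1 : (f k).1 ∣ k := ⟨(f k).2 ^ 2, by rw [mul_comm, hf1]⟩
    have hd2 : (f k).2 ∣ k := (dvd_pow_self _ two_ne_zero).trans ⟨(f k).1, (hf1 k).symm⟩
    refine mem_product.2 ⟨mem_sieveModuli.2 ⟨⟨Nat.pos_of_dvd_of_pos hd1 hk0,
      (Nat.le_of_dvd hk0 hd1).trans hk.1.2⟩, hf2 k, fun p hp hpd => ?_⟩,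
      mem_Icc.2 ⟨Nat.pos_of_dvd_of_pos hd2 hk0, (Nat.le_of_dvd hk0 hd2).trans hk.1.2⟩⟩
    by_contra hlt
    push Not at hlt
    have h1 : p ∣ P.factorial := Nat.dvd_factorial hp.pos hlt.le
    have h2 : k % p = 1 % p := (Nat.ModEq.of_dvd h1 hk.2 : k ≡ 1 [MOD p])
    rw [Nat.mod_eq_zero_of_dvd (hpd.trans hd1), Nat.mod_eq_of_lt hp.one_lt] at h2
    omega
  calc ∑ k ∈ K, 1 / (k : ℝ) = ∑ k ∈ K, 1 / ((f k).1 : ℝ) * (1 / ((f k).2 : ℝ) ^ 2) := by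
        refine sum_congr rfl fun k _ => ?_
        rw [one_div_mul_one_div, mul_comm]
        congr 1
        exact_mod_cast (hf1 k).symm
    _ = ∑ p ∈ K.image f, 1 / (p.1 : ℝ) * (1 / (p.2 : ℝ) ^ 2) :=
        (sum_image (f := fun p : ℕ × ℕ => 1 / (p.1 : ℝ) * (1 / (p.2 : ℝ) ^ 2))
          fun _ _ _ _ h => hinj h).symm
    _ ≤ ∑ p ∈ sieveModuli P Q ×ˢ Icc 1 Q, 1 / (p.1 : ℝ) * (1 / (p.2 : ℝ) ^ 2) :=
        sum_le_sum_of_subset_of_nonneg hsub fun _ _ _ => by positivity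
    _ = sieveMass P Q * ∑ r ∈ Icc 1 Q, 1 / (r : ℝ) ^ 2 := by
        rw [sum_product, sieveMass, sum_mul_sum]
    _ ≤ sieveMass P Q * 2 := by
        refine mul_le_mul_of_nonneg_left ?_ (sum_nonneg fun _ _ => by positivity)
        refine le_trans (le_of_eq ?_) (sum_range_one_div_succ_sq_le Q)
        rw [← Ico_add_one_right_eq_Icc, sum_Ico_eq_sum_range]
        refine sum_congr (by simp) fun r _ => ?_
        push_cast
        rw [add_comm]
    _ = _ := mul_comm _ _

theorem harmonicSum_eq (Q : ℕ) : harmonicSum Q = harmonic Q := by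
  rw [harmonicSum, harmonic_eq_sum_Icc]
  push_cast
  simp

theorem log_le_sieveMass (P : ℕ) {Q : ℕ} (hQ : 1 ≤ Q) :
    Real.log Q ≤ (2 * P.factorial + Real.log P.factorial) * sieveMass P Q := by
  set M := P.factorial with hM
  have hM0 : 0 < M := Nat.factorial_pos P
  have hM1 : (1 : ℝ) ≤ M := by exact_mod_cast hM0
  set I := (Q - 1) / M + 1 with hI
  have h1 : ∑ i ∈ range I, 1 / ((1 + M * i : ℕ) : ℝ) ≤
      ∑ k ∈ Icc 1 Q with k % M = 1 % M, 1 / (k : ℝ) := by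
    rw [← sum_image (f := fun k : ℕ => 1 / (k : ℝ)) (g := fun i => 1 + M * i)]
    · refine sum_le_sum_of_subset_of_nonneg ?_ fun _ _ _ => by positivity
      intro k hk
      obtain ⟨i, hi, rfl⟩ := mem_image.1 hk
      rw [mem_filter, mem_Icc]
      have h2 : i ≤ (Q - 1) / M := by have := mem_range.1 hi; omega
      have h3 : M * i ≤ Q - 1 := (Nat.mul_le_mul_left M h2).trans (Nat.mul_div_le _ _)
      exact ⟨⟨by omega, by omega⟩, by rw [Nat.add_mul_mod_self_left]⟩
    · intro a _ b _ hab
      exact Nat.eq_of_mul_eq_mul_left hM0 (Nat.add_left_cancel hab)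
  have h2 : 1 / (M : ℝ) * harmonic I ≤ ∑ i ∈ range I, 1 / ((1 + M * i : ℕ) : ℝ) := by
    rw [harmonic]
    push_cast
    rw [mul_sum]
    refine sum_le_sum fun i _ => ?_
    rw [← one_div, one_div_mul_one_div]
    refine one_div_le_one_div_of_le (by positivity) ?_
    linarith
  have h3 : Real.log Q - Real.log M ≤ harmonic I := by
    refine le_trans ?_ (log_add_one_le_harmonic I)
    have hQ0 : (0 : ℝ) < Q := by exact_mod_cast hQ
    rw [← Real.log_div hQ0.ne' (by positivity)]
    refine Real.log_le_log (by positivity) ?_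
    rw [div_le_iff₀ (by positivity)]
    have h4 : Q ≤ (I + 1) * M := by
      have h5 := Nat.lt_mul_div_succ (Q - 1) hM0
      have h6 : (I + 1) * M = M * ((Q - 1) / M + 1) + M := by rw [hI]; ring
      omega
    exact_mod_cast h4
  have h4 := sum_one_div_modEq_one_le P Q
  have h5 : (harmonic I : ℝ) ≤ M * (2 * sieveMass P Q) := by
    have := h2.trans (h1.trans h4)
    rwa [one_div_mul_eq_div, div_le_iff₀ (by positivity), mul_comm] at this
  have h6 := one_le_sieveMass (P := P) hQ
  have h7 : 0 ≤ Real.log M := Real.log_nonneg hM1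
  nlinarith

theorem squarefree_lcm {a b : ℕ} (ha : Squarefree a) (hb : Squarefree b) :
    Squarefree (a.lcm b) := by
  have ha0 := ha.ne_zero
  have hb0 := hb.ne_zero
  rw [Nat.squarefree_iff_factorization_le_one (Nat.lcm_ne_zero ha0 hb0)]
  intro p
  rw [Nat.factorization_lcm ha0 hb0, Finsupp.sup_apply]
  exact sup_le (ha.natFactorization_le_one p) (hb.natFactorization_le_one p)

theorem mem_diffSet_sieveModuli {P Q : ℕ} {z : ℚ} (hz : z ∈ diffSet (sieveModuli P Q)) :
    0 ≤ z ∧ z < 1 ∧ z.den ≤ Q ^ 2 ∧ Squarefree z.den ∧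
      ∀ p : ℕ, p.Prime → p ∣ z.den → P ≤ p := by
  obtain ⟨⟨x, y⟩, hxy, h⟩ := mem_image.1 hz
  rw [mem_product, mem_fareySet, mem_fareySet] at hxy
  have hx := mem_sieveModuli.1 hxy.1.2.2
  have hy := mem_sieveModuli.1 hxy.2.2.2
  have hd := den_dvd_lcm_of_fract_sub_eq h
  refine ⟨h ▸ Int.fract_nonneg _, h ▸ Int.fract_lt_one _, ?_,
    (squarefree_lcm hx.2.1 hy.2.1).squarefree_of_dvd hd, fun p hp hpd => ?_⟩
  · refine (Nat.le_of_dvd (Nat.mul_pos hx.1.1 hy.1.1) (hd.trans (Nat.lcm_dvd_mul _ _))).trans ?_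
    rw [sq]
    exact Nat.mul_le_mul hx.1.2 hy.1.2
  · have := (hpd.trans hd).trans (Nat.lcm_dvd_mul _ _)
    rcases hp.dvd_mul.1 this with h' | h'
    · exact hx.2.2 p hp h'
    · exact hy.2.2 p hp h'

theorem card_divisors_pow_le {B q : ℕ} (hq : Squarefree q)
    (h : ∀ p : ℕ, p.Prime → p ∣ q → 2 ^ B ≤ p) {r : ℝ} {e w : ℕ} (hr : 1 ≤ r)
    (hB : (2 : ℝ) ^ e ≤ r ^ B) (hw : q < 2 ^ w) : (#q.divisors : ℝ) ^ e ≤ r ^ w := by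
  have h1 : #q.divisors ≤ 2 ^ #q.primeFactors := by
    rw [Nat.card_divisors hq.ne_zero, ← prod_const]
    refine prod_le_prod' fun p _ => ?_
    have := hq.natFactorization_le_one p
    omega
  have h2 : 2 ^ (B * #q.primeFactors) ≤ q := by
    rw [pow_mul, ← prod_const]
    conv_rhs => rw [← Nat.prod_primeFactors_of_squarefree hq]
    exact prod_le_prod' fun p hp => h p (Nat.prime_of_mem_primeFactors hp)
      (Nat.dvd_of_mem_primeFactors hp)
  have h3 : B * #q.primeFactors ≤ w := (Nat.pow_lt_pow_iff_right one_lt_two).1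
    (h2.trans_lt hw) |>.le
  calc (#q.divisors : ℝ) ^ e ≤ ((2 : ℝ) ^ #q.primeFactors) ^ e :=
        pow_le_pow_left₀ (by positivity) (by exact_mod_cast h1) e
    _ = ((2 : ℝ) ^ e) ^ #q.primeFactors := by rw [← pow_mul, ← pow_mul, mul_comm]
    _ ≤ (r ^ B) ^ #q.primeFactors := pow_le_pow_left₀ (by positivity) hB _
    _ = r ^ (B * #q.primeFactors) := (pow_mul _ _ _).symm
    _ ≤ r ^ w := pow_le_pow_right₀ hr h3

theorem one_div_le_abs_mul_sub {x : ℚ} {c d : ℕ} (hx : x.den ≠ 1) (hd : x.den ∣ d) (hd0 : 0 < d)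
    (hc : d.Coprime c) (k : ℤ) : 1 / (d : ℝ) ≤ |(c : ℝ) * x - k| := by
  have h1 : ((c : ℚ) * x - k).den ∣ d := by
    rw [den_dvd_iff] at hd ⊢
    obtain ⟨z, hz⟩ := hd
    exact ⟨c * z - d * k, by push_cast; linear_combination (c : ℚ) * hz⟩
  have h2 : (c : ℚ) * x - k ≠ 0 := by
    intro h
    have h3 : x.den ∣ c := den_dvd_iff.2 ⟨k, sub_eq_zero.1 h⟩
    exact hx (Nat.eq_one_of_dvd_coprimes hc hd h3)
  have := one_div_le_abs_of_den_dvd h1 hd0 h2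
  push_cast at this
  exact this

theorem den_sub_ne_one {x y : ℚ} (hx : 0 ≤ x) (hx1 : x < 1) (hy : 0 ≤ y) (hy1 : y < 1)
    (hxy : x ≠ y) : (x - y).den ≠ 1 := by
  intro h
  refine hxy (sub_eq_zero.1 (den_eq_one_of_abs_lt (n := 1) (by rw [h]) ?_ one_pos))
  rw [Nat.cast_one, one_mul, abs_lt]
  constructor <;> linarith

theorem two_mul_le_abs_sin_pi_mul {δ y : ℝ} (h : ∀ k : ℤ, δ ≤ |y - k|) :
    2 * δ ≤ |Real.sin (Real.pi * y)| := by
  have e : |Real.sin (Real.pi * y)| = |Real.sin (Real.pi * Int.fract y)| := by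
    have : 2 * |Real.sin (Real.pi * y)| = 2 * |Real.sin (Real.pi * Int.fract y)| := by
      rw [← norm_one_sub_unitExp, ← norm_one_sub_unitExp]
      conv_lhs => rw [← Int.fract_add_floor y, unitExp_add_intCast]
    linarith
  rw [e]
  have h0 := Int.fract_nonneg y
  have h1 := Int.fract_lt_one y
  have h2 : δ ≤ Int.fract y := by
    have := h ⌊y⌋
    rwa [← Int.fract, abs_of_nonneg h0] at this
  have h3 : δ ≤ 1 - Int.fract y := by
    have := h (⌊y⌋ + 1)
    push_cast at this
    rwa [← sub_sub, ← Int.fract, abs_of_neg (by linarith), neg_sub] at this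
  rcases le_total (Int.fract y) (1 / 2) with ht | ht
  · have := two_mul_le_sin_pi_mul h0 ht
    exact le_trans (by linarith) (le_abs_self _)
  · have := two_mul_le_sin_pi_mul (x := 1 - Int.fract y) (by linarith) (by linarith)
    rw [mul_sub Real.pi, mul_one, Real.sin_pi_sub] at this
    exact le_trans (by linarith) (le_abs_self _)

theorem wellSpaced_diffSet {P t m : ℕ} (h : 4 * t ≤ m) :
    WellSpaced (diffSet (sieveModuli P (2 ^ t))) (fun z : ℚ => (z : ℝ)) (2 ^ m) := by
  intro x hx y hy hxy k
  obtain ⟨hx0, hx1, hxd, -, -⟩ := mem_diffSet_sieveModuli hx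
  obtain ⟨hy0, hy1, hyd, -, -⟩ := mem_diffSet_sieveModuli hy
  have h1 := one_div_le_abs_mul_sub (c := 1) (den_sub_ne_one hx0 hx1 hy0 hy1 hxy)
    (Rat.sub_den_dvd x y) (Nat.mul_pos x.den_pos y.den_pos) (Nat.coprime_one_right _) k
  push_cast at h1
  rw [one_mul] at h1
  refine le_trans ?_ h1
  have h2 : x.den * y.den ≤ 2 ^ m := by
    calc x.den * y.den ≤ (2 ^ t) ^ 2 * (2 ^ t) ^ 2 := Nat.mul_le_mul hxd hyd
      _ = 2 ^ (4 * t) := by ring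
      _ ≤ 2 ^ m := Nat.pow_le_pow_right two_pos h
  refine one_div_le_one_div_of_le ?_ (by exact_mod_cast h2)
  exact_mod_cast Nat.mul_pos x.den_pos y.den_pos

theorem coprime_three_mul_two_pow {d : ℕ} (h : ∀ p : ℕ, p.Prime → p ∣ d → 4 ≤ p) (a : ℕ) :
    d.Coprime (3 * 2 ^ a) := by
  have h2 : d.Coprime 2 := by
    rw [Nat.coprime_comm, Nat.prime_two.coprime_iff_not_dvd]
    intro hd
    have := h 2 Nat.prime_two hd
    omega
  have h3 : d.Coprime 3 := by
    rw [Nat.coprime_comm, Nat.prime_three.coprime_iff_not_dvd]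
    intro hd
    have := h 3 Nat.prime_three hd
    omega
  exact h3.mul_right (h2.pow_right a)

theorem sum_rieszProd_dyadic_le {s : Finset ℚ} {w m a : ℕ} (hw : 0 < w) (hwm : w ≤ m)
    (h01 : ∀ z ∈ s, 0 < z ∧ z < 1) (hd : ∀ z ∈ s, z.den < 2 ^ w)
    (hP : ∀ z ∈ s, ∀ p : ℕ, p.Prime → p ∣ z.den → 4 ≤ p) :
    ∑ z ∈ s, rieszProd m (3 * 2 ^ a * z) ≤
      16 * 4 ^ w * (35 / 36) ^ w * (143 / 144) ^ (m / w - 1) := by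
  have hws : WellSpaced s (fun z : ℚ => 3 * 2 ^ a * (z : ℝ)) (4 ^ w) := by
    intro x hx y hy hxy k
    have hc : (x.den * y.den).Coprime (3 * 2 ^ a) :=
      (coprime_three_mul_two_pow (hP x hx) a).mul_left (coprime_three_mul_two_pow (hP y hy) a)
    have h1 := one_div_le_abs_mul_sub (den_sub_ne_one (h01 x hx).1.le (h01 x hx).2
      (h01 y hy).1.le (h01 y hy).2 hxy) (Rat.sub_den_dvd x y)
      (Nat.mul_pos x.den_pos y.den_pos) hc k
    push_cast at h1
    rw [mul_sub] at h1
    refine le_trans ?_ h1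
    have h2 : x.den * y.den ≤ 4 ^ w := by
      calc x.den * y.den ≤ 2 ^ w * 2 ^ w := Nat.mul_le_mul (hd x hx).le (hd y hy).le
        _ = 4 ^ w := by rw [← mul_pow]; norm_num
    refine one_div_le_one_div_of_le ?_ (by exact_mod_cast h2)
    exact_mod_cast Nat.mul_pos x.den_pos y.den_pos
  calc ∑ z ∈ s, rieszProd m (3 * 2 ^ a * z)
      ≤ ∑ z ∈ s, rieszProd w (3 * 2 ^ a * z) * (143 / 144) ^ (m / w - 1) := by
        refine sum_le_sum fun z hz => rieszProd_le_mul_pow hw hwm fun i => ?_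
        have hne : z.den ≠ 1 := by
          have := den_sub_ne_one (h01 z hz).1.le (h01 z hz).2 le_rfl zero_lt_one (h01 z hz).1.ne'
          rwa [sub_zero] at this
        have h1 := two_mul_le_abs_sin_pi_mul (y := 4 ^ i * (3 * 2 ^ a * (z : ℝ)))
          (δ := 1 / z.den) fun k => by
            have h2 := one_div_le_abs_mul_sub hne dvd_rfl z.den_pos
              (coprime_three_mul_two_pow (hP z hz) (a + 2 * i)) k
            have e : 4 ^ i * (3 * 2 ^ a * (z : ℝ)) = ((3 * 2 ^ (a + 2 * i) : ℕ) : ℝ) * z := by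
              push_cast
              rw [pow_add, pow_mul]
              norm_num
              ring
            rwa [e]
        have hden : (0 : ℝ) < z.den := by exact_mod_cast z.den_pos
        have h3 : (z.den : ℝ) < 2 ^ w := by exact_mod_cast hd z hz
        have h4 : 1 < 2 ^ w * (2 * (1 / (z.den : ℝ))) := by
          have : 2 ^ w * (2 * (1 / (z.den : ℝ))) = 2 * 2 ^ w / z.den := by ring
          rw [this, one_lt_div hden]
          linarith
        exact h4.trans_le (mul_le_mul_of_nonneg_left h1 (by positivity))
    _ = (∑ z ∈ s, rieszProd w (3 * 2 ^ a * z)) * (143 / 144) ^ (m / w - 1) :=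
        (sum_mul _ _ _).symm
    _ ≤ _ := mul_le_mul_of_nonneg_right hws.sum_rieszProd_le (by positivity)

theorem sqrt_le_add_div (m : ℕ) {w : ℕ} (hw : 0 < w) : Nat.sqrt m ≤ w + m / w := by
  rcases le_total (Nat.sqrt m) w with h | h
  · exact h.trans (Nat.le_add_right _ _)
  · refine le_trans ?_ (Nat.le_add_left _ _)
    rw [Nat.le_div_iff_mul_le hw]
    exact (Nat.mul_le_mul_left _ h).trans (Nat.sqrt_le m)

theorem dyadic_factor_le {w m : ℕ} (hw : 0 < w) (hwm : w ≤ m) :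
    (70 / 71 : ℝ) ^ w * (143 / 144) ^ (m / w - 1) ≤ 2 * (143 / 144) ^ Nat.sqrt m := by
  have h1 : 1 ≤ m / w := (Nat.one_le_div_iff hw).2 hwm
  have h2 : (70 / 71 : ℝ) ^ w ≤ (143 / 144) ^ w :=
    pow_le_pow_left₀ (by norm_num) (by norm_num) w
  have h3 : (143 / 144 : ℝ) ^ (m / w - 1) ≤ 2 * (143 / 144) ^ (m / w) := by
    have e : m / w = m / w - 1 + 1 := by omega
    conv_rhs => rw [e, pow_succ]
    have : (0 : ℝ) < (143 / 144) ^ (m / w - 1) := by positivity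
    linarith
  calc (70 / 71 : ℝ) ^ w * (143 / 144) ^ (m / w - 1)
      ≤ (143 / 144) ^ w * (2 * (143 / 144) ^ (m / w)) :=
        mul_le_mul h2 h3 (by positivity) (by positivity)
    _ = 2 * (143 / 144) ^ (w + m / w) := by rw [pow_add]; ring
    _ ≤ 2 * (143 / 144) ^ Nat.sqrt m := by
        refine mul_le_mul_of_nonneg_left ?_ (by norm_num)
        exact pow_le_pow_of_le_one (by norm_num) (by norm_num) (sqrt_le_add_div m hw)

/-- The weighted average of the Riesz product over nonzero frequencies is small. -/
theorem sum_autocorr_sq_mul_rieszProd_le {B t m : ℕ} (hB2 : 2 ≤ B)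
    (hB : (2 : ℝ) ^ 6 ≤ (72 / 71) ^ B) (htm : 2 * t + 1 ≤ m) (a : ℕ) :
    ∑ z ∈ (diffSet (sieveModuli (2 ^ B) (2 ^ t))).erase 0,
      autocorr (sieveModuli (2 ^ B) (2 ^ t)) z ^ 2 * rieszProd m (3 * 2 ^ a * z) ≤
      (2 * t + 1) * (128 * harmonicSum (2 ^ t) ^ 6 * (143 / 144) ^ Nat.sqrt m) := by
  set A := sieveModuli (2 ^ B) (2 ^ t) with hA
  set h := harmonicSum (2 ^ t) with hh
  have hh0 : 0 ≤ h := sum_nonneg fun _ _ => by positivity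
  have hmaps : ∀ z ∈ (diffSet A).erase 0, Nat.log 2 z.den ∈ range (2 * t + 1) := by
    intro z hz
    have := (mem_diffSet_sieveModuli (mem_of_mem_erase hz)).2.2.1
    rw [mem_range, Nat.lt_succ_iff, ← Nat.log_pow one_lt_two (2 * t)]
    refine Nat.log_mono_right (this.trans_eq ?_)
    rw [← pow_mul, mul_comm]
  have hclass : ∀ s ∈ range (2 * t + 1),
      ∑ z ∈ (diffSet A).erase 0 with Nat.log 2 z.den = s,
        autocorr A z ^ 2 * rieszProd m (3 * 2 ^ a * z) ≤
      128 * h ^ 6 * (143 / 144) ^ Nat.sqrt m := by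
    intro s hs
    have hs' := mem_range.1 hs
    have hmem : ∀ z ∈ {z ∈ (diffSet A).erase 0 | Nat.log 2 z.den = s},
        (0 < z ∧ z < 1) ∧ Squarefree z.den ∧ (∀ p : ℕ, p.Prime → p ∣ z.den → 2 ^ B ≤ p) ∧
          2 ^ s ≤ z.den ∧ z.den < 2 ^ (s + 1) := by
      intro z hz
      rw [mem_filter, mem_erase] at hz
      obtain ⟨h0, h1, -, h3, h4⟩ := mem_diffSet_sieveModuli hz.1.2
      refine ⟨⟨lt_of_le_of_ne h0 (Ne.symm hz.1.1), h1⟩, h3, h4, ?_, ?_⟩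
      · rw [← hz.2]; exact Nat.pow_log_le_self 2 z.den_nz
      · rw [← hz.2]; exact Nat.lt_pow_succ_log_self one_lt_two _
    have h4B : 4 ≤ 2 ^ B := by
      calc 4 = 2 ^ 2 := by norm_num
        _ ≤ 2 ^ B := Nat.pow_le_pow_right two_pos hB2
    have hR := sum_rieszProd_dyadic_le (s := {z ∈ (diffSet A).erase 0 | Nat.log 2 z.den = s})
      (w := s + 1) (m := m) (a := a) (by omega) (by omega) (fun z hz => (hmem z hz).1)
      (fun z hz => (hmem z hz).2.2.2.2)
      (fun z hz p hp hpd => h4B.trans ((hmem z hz).2.2.1 p hp hpd))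
    calc ∑ z ∈ (diffSet A).erase 0 with Nat.log 2 z.den = s,
          autocorr A z ^ 2 * rieszProd m (3 * 2 ^ a * z)
        ≤ ∑ z ∈ (diffSet A).erase 0 with Nat.log 2 z.den = s,
          (h ^ 6 * (72 / 71) ^ (s + 1) * (4 * (1 / 4 ^ (s + 1)))) *
            rieszProd m (3 * 2 ^ a * z) := by
          refine sum_le_sum fun z hz => mul_le_mul_of_nonneg_right ?_ (rieszProd_nonneg _ _)
          obtain ⟨-, hsq, hp, hlo, hhi⟩ := hmem z hz
          have h1 := abs_autocorr_le (sieveModuli_subset (2 ^ B) (2 ^ t)) z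
          have h2 := card_divisors_pow_le hsq hp (by norm_num) hB hhi
          rw [← sq_abs]
          refine (pow_le_pow_left₀ (abs_nonneg _) h1 2).trans ?_
          have hden : (2 : ℝ) ^ s ≤ z.den := by exact_mod_cast hlo
          have h3 : (4 : ℝ) ^ s ≤ (z.den : ℝ) ^ 2 := by
            calc (4 : ℝ) ^ s = (2 ^ s) ^ 2 := by rw [← pow_mul, mul_comm, pow_mul]; norm_num
              _ ≤ _ := pow_le_pow_left₀ (by positivity) hden 2
          have e1 : (4 : ℝ) * (1 / 4 ^ (s + 1)) = 1 / 4 ^ s := by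
            rw [pow_succ]; field_simp
          rw [e1, div_pow, ← pow_mul, mul_pow, ← hh, mul_one_div, mul_comm (h ^ 6)]
          norm_num only [Nat.reduceMul]
          exact div_le_div₀ (by positivity) (mul_le_mul_of_nonneg_right h2 (by positivity))
            (by positivity) h3
      _ = h ^ 6 * (72 / 71) ^ (s + 1) * (4 * (1 / 4 ^ (s + 1))) *
          ∑ z ∈ (diffSet A).erase 0 with Nat.log 2 z.den = s, rieszProd m (3 * 2 ^ a * z) :=
          (mul_sum _ _ _).symm
      _ ≤ h ^ 6 * (72 / 71) ^ (s + 1) * (4 * (1 / 4 ^ (s + 1))) *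
          (16 * 4 ^ (s + 1) * (35 / 36) ^ (s + 1) * (143 / 144) ^ (m / (s + 1) - 1)) :=
          mul_le_mul_of_nonneg_left hR (by positivity)
      _ = 64 * h ^ 6 * ((70 / 71) ^ (s + 1) * (143 / 144) ^ (m / (s + 1) - 1)) := by
          have e2 : (70 / 71 : ℝ) ^ (s + 1) = (72 / 71) ^ (s + 1) * (35 / 36) ^ (s + 1) := by
            rw [← mul_pow]; norm_num
          rw [e2]
          field_simp
          ring
      _ ≤ 64 * h ^ 6 * (2 * (143 / 144) ^ Nat.sqrt m) :=
          mul_le_mul_of_nonneg_left (dyadic_factor_le (by omega) (by omega)) (by positivity)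
      _ = _ := by ring
  rw [← sum_fiberwise_of_maps_to hmaps]
  refine (sum_le_sum hclass).trans (le_of_eq ?_)
  rw [sum_const, card_range, nsmul_eq_mul]
  push_cast
  rfl

theorem cosProd_le_one (n m : ℕ) (x y : ℝ) : cosProd n m x y ≤ 1 :=
  prod_le_one (fun _ _ => abs_nonneg _) fun _ _ => Real.abs_cos_le_one _

theorem mul_mul_le_sq_add_sq {a b p q M R₁ R₂ : ℝ} (hM : 0 ≤ M) (h₁ : M ≤ R₁) (h₂ : M ≤ R₂) :
    a * b * (p * q * M) ≤ (b ^ 2 * R₂) * p ^ 2 / 2 + (a ^ 2 * R₁) * q ^ 2 / 2 := by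
  have h3 : b ^ 2 * M * p ^ 2 ≤ b ^ 2 * R₂ * p ^ 2 := by gcongr
  have h4 : a ^ 2 * M * q ^ 2 ≤ a ^ 2 * R₁ * q ^ 2 := by gcongr
  nlinarith [mul_nonneg hM (sq_nonneg (b * p - a * q))]

/-- An `ℓ²` large sieve bound for the bilinear form with kernel `cosProd n n`. -/
theorem sum_sum_mul_cosProd_le {s : Finset ℚ} {n m : ℕ} (hn : 4 * m ≤ n)
    (hs : WellSpaced s (fun z : ℚ => (z : ℝ)) (2 ^ m)) (c : ℚ → ℝ) {E : ℝ}
    (hE : ∀ a : ℕ, ∑ z ∈ s, c z ^ 2 * rieszProd m (3 * 2 ^ a * z) ≤ E) :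
    ∑ z ∈ s, ∑ w ∈ s, |c z| * |c w| * cosProd n n z w ≤ 16 * E := by
  have key : ∀ a : ℕ, ∑ z ∈ s, ∑ w ∈ s,
      (c z ^ 2 * rieszProd m (3 * 2 ^ a * z)) * cosProd n m w z ^ 2 / 2 ≤ 8 * E := by
    intro a
    calc ∑ z ∈ s, ∑ w ∈ s, (c z ^ 2 * rieszProd m (3 * 2 ^ a * z)) * cosProd n m w z ^ 2 / 2
        = ∑ z ∈ s, (c z ^ 2 * rieszProd m (3 * 2 ^ a * z)) / 2 *
            ∑ w ∈ s, cosProd n m w z ^ 2 := by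
          refine sum_congr rfl fun z _ => ?_
          rw [mul_sum]
          exact sum_congr rfl fun w _ => by ring
      _ ≤ ∑ z ∈ s, (c z ^ 2 * rieszProd m (3 * 2 ^ a * z)) / 2 * 16 := by
          refine sum_le_sum fun z _ => mul_le_mul_of_nonneg_left (hs.sum_cosProd_sq_le n z) ?_
          have := rieszProd_nonneg m (3 * 2 ^ a * (z : ℝ))
          positivity
      _ = 8 * ∑ z ∈ s, c z ^ 2 * rieszProd m (3 * 2 ^ a * z) := by
          rw [mul_sum]
          exact sum_congr rfl fun z _ => by ring
      _ ≤ 8 * E := by linarith [hE a]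
  calc ∑ z ∈ s, ∑ w ∈ s, |c z| * |c w| * cosProd n n z w
      ≤ ∑ z ∈ s, ∑ w ∈ s,
        ((c w ^ 2 * rieszProd m (3 * 2 ^ (n - 3 * m) * w)) * cosProd n m z w ^ 2 / 2 +
          (c z ^ 2 * rieszProd m (3 * 2 ^ m * z)) * cosProd n m w z ^ 2 / 2) := by
        refine sum_le_sum fun z _ => sum_le_sum fun w _ => ?_
        obtain ⟨M, hM, h1, h2, h3⟩ := exists_cosProd_le hn (z : ℝ) (w : ℝ)
        refine (mul_le_mul_of_nonneg_left h3 (by positivity)).trans ?_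
        rw [← sq_abs (c w), ← sq_abs (c z)]
        exact mul_mul_le_sq_add_sq hM h1 h2
    _ ≤ 8 * E + 8 * E := by
        simp only [sum_add_distrib]
        refine add_le_add ?_ (key m)
        rw [sum_comm]
        exact key (n - 3 * m)
    _ = 16 * E := by ring

/-- A linear version of `sum_sum_mul_cosProd_le` for a kernel bounded by `cosProd n m * R`. -/
theorem sum_mul_le_sqrt {s : Finset ℚ} {n m : ℕ}
    (hs : WellSpaced s (fun z : ℚ => (z : ℝ)) (2 ^ m)) (c : ℚ → ℝ) {E : ℝ} (a : ℕ)
    (hE : ∑ z ∈ s, c z ^ 2 * rieszProd m (3 * 2 ^ a * z) ≤ E) (K : ℚ → ℝ)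
    (hK : ∀ z ∈ s, K z ≤ cosProd n m z 0 * rieszProd m (3 * 2 ^ a * z)) :
    ∑ z ∈ s, |c z| * K z ≤ 4 * Real.sqrt E := by
  set R : ℚ → ℝ := fun z => rieszProd m (3 * 2 ^ a * z) with hR
  have hR0 : ∀ z, 0 ≤ R z := fun z => rieszProd_nonneg _ _
  have hR1 : ∀ z, R z ≤ 1 := fun z => rieszProd_le_one _ _
  have hE0 : 0 ≤ E := le_trans (sum_nonneg fun z _ => mul_nonneg (sq_nonneg _) (hR0 z)) hE
  calc ∑ z ∈ s, |c z| * K z ≤ ∑ z ∈ s, |c z| * R z * cosProd n m z 0 := by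
        refine sum_le_sum fun z hz => ?_
        rw [mul_assoc, mul_comm (R z)]
        exact mul_le_mul_of_nonneg_left (hK z hz) (abs_nonneg _)
    _ ≤ Real.sqrt (16 * E) := by
        refine Real.le_sqrt_of_sq_le ?_
        refine (sum_mul_sq_le_sq_mul_sq _ _ _).trans ?_
        have h1 : ∑ z ∈ s, (|c z| * R z) ^ 2 ≤ E := by
          refine le_trans (sum_le_sum fun z _ => ?_) hE
          rw [mul_pow, sq_abs]
          refine mul_le_mul_of_nonneg_left ?_ (sq_nonneg _)
          nlinarith [hR0 z, hR1 z]
        rw [mul_comm]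
        exact mul_le_mul (hs.sum_cosProd_sq_le n 0) h1 (sum_nonneg fun _ _ => sq_nonneg _)
          (by norm_num)
    _ = 4 * Real.sqrt E := by
        rw [Real.sqrt_mul (by norm_num)]
        congr 1
        rw [show (16 : ℝ) = 4 ^ 2 by norm_num]
        exact Real.sqrt_sq (by norm_num)

theorem WellSpaced.mono {ι : Type*} {s t : Finset ι} {y : ι → ℝ} {N : ℕ} (h : WellSpaced t y N)
    (hst : s ⊆ t) : WellSpaced s y N := fun i hi j hj => h i (hst hi) j (hst hj)

/-- The full bilinear form is the contribution of the zero frequency plus small terms. -/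
theorem sum_sum_mul_cosProd_le_of_erase {s : Finset ℚ} {n m : ℕ} (hn : 4 * m ≤ n)
    (hs : WellSpaced s (fun z : ℚ => (z : ℝ)) (2 ^ m)) (c : ℚ → ℝ) {E S : ℝ} (hS : |c 0| ≤ S)
    (hE : ∀ a : ℕ, ∑ z ∈ s.erase 0, c z ^ 2 * rieszProd m (3 * 2 ^ a * z) ≤ E) :
    ∑ z ∈ s, ∑ w ∈ s, |c z| * |c w| * cosProd n n z w ≤
      S ^ 2 + 8 * S * Real.sqrt E + 16 * E := by
  set T := s.erase 0 with hT
  have hTs : WellSpaced T (fun z : ℚ => (z : ℝ)) (2 ^ m) := hs.mono (erase_subset _ _)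
  have hterm : ∀ z w, 0 ≤ |c z| * |c w| * cosProd n n z w := fun z w =>
    mul_nonneg (by positivity) (cosProd_nonneg _ _ _ _)
  have hsub : s ⊆ insert 0 T := by
    intro z hz
    rw [mem_insert, hT, mem_erase]
    tauto
  have hS0 : 0 ≤ S := (abs_nonneg _).trans hS
  have h0 : (0 : ℚ) ∉ T := notMem_erase 0 s
  have hrow : ∑ w ∈ T, |c 0| * |c w| * cosProd n n (0 : ℚ) w ≤ S * (4 * Real.sqrt E) := by
    have := sum_mul_le_sqrt (n := n) hTs c (n - 3 * m) (hE _) (fun w => cosProd n n (0 : ℚ) w)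
      fun w _ => by
        obtain ⟨M, hM, -, h2, h3⟩ := exists_cosProd_le hn ((0 : ℚ) : ℝ) (w : ℝ)
        refine h3.trans ?_
        have h4 := cosProd_le_one n m ((0 : ℚ) : ℝ) (w : ℝ)
        have h5 := cosProd_nonneg n m (w : ℝ) ((0 : ℚ) : ℝ)
        rw [Rat.cast_zero] at *
        exact mul_le_mul (mul_le_of_le_one_left h5 h4) h2 hM h5
    simp only [mul_assoc, ← mul_sum]
    exact mul_le_mul hS this (sum_nonneg fun w _ => mul_nonneg (abs_nonneg _)
      (cosProd_nonneg _ _ _ _)) hS0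
  have hcol : ∑ z ∈ T, |c z| * |c 0| * cosProd n n z (0 : ℚ) ≤ S * (4 * Real.sqrt E) := by
    have := sum_mul_le_sqrt (n := n) hTs c m (hE _) (fun z => cosProd n n z (0 : ℚ))
      fun z _ => by
        obtain ⟨M, hM, h1, -, h3⟩ := exists_cosProd_le hn (z : ℝ) ((0 : ℚ) : ℝ)
        refine h3.trans ?_
        have h4 := cosProd_le_one n m ((0 : ℚ) : ℝ) (z : ℝ)
        have h5 := cosProd_nonneg n m (z : ℝ) ((0 : ℚ) : ℝ)
        rw [Rat.cast_zero] at *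
        exact mul_le_mul (mul_le_of_le_one_right h5 h4) h1 hM h5
    simp only [mul_comm |c _| |c 0|, mul_assoc, ← mul_sum]
    exact mul_le_mul hS this (sum_nonneg fun w _ => mul_nonneg (abs_nonneg _)
      (cosProd_nonneg _ _ _ _)) hS0
  have hdiag : |c 0| * |c 0| * cosProd n n (0 : ℚ) (0 : ℚ) ≤ S ^ 2 := by
    rw [sq]
    exact (mul_le_of_le_one_right (by positivity) (cosProd_le_one _ _ _ _)).trans
      (mul_le_mul hS hS (abs_nonneg _) hS0)
  calc ∑ z ∈ s, ∑ w ∈ s, |c z| * |c w| * cosProd n n z w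
      ≤ ∑ z ∈ insert 0 T, ∑ w ∈ insert 0 T, |c z| * |c w| * cosProd n n z w :=
        (sum_le_sum fun z _ => sum_le_sum_of_subset_of_nonneg hsub fun w _ _ => hterm z w).trans
          (sum_le_sum_of_subset_of_nonneg hsub fun z _ _ => sum_nonneg fun w _ => hterm z w)
    _ = (|c 0| * |c 0| * cosProd n n (0 : ℚ) (0 : ℚ) +
          ∑ w ∈ T, |c 0| * |c w| * cosProd n n (0 : ℚ) w) +
        (∑ z ∈ T, |c z| * |c 0| * cosProd n n z (0 : ℚ) +
          ∑ z ∈ T, ∑ w ∈ T, |c z| * |c w| * cosProd n n z w) := by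
        simp only [sum_insert h0, sum_add_distrib]
    _ ≤ (S ^ 2 + S * (4 * Real.sqrt E)) + (S * (4 * Real.sqrt E) + 16 * E) :=
        add_le_add (add_le_add hdiag hrow) (add_le_add hcol (sum_sum_mul_cosProd_le hn hTs c hE))
    _ = _ := by ring

theorem two_pow_le_binaryReversal_of_odd {n k : ℕ} (hn : 1 ≤ n) (hk : k % 2 = 1) :
    2 ^ (n - 1) ≤ binaryReversal n k := by
  refine le_trans ?_ (single_le_sum (f := fun j => binaryDigit j k * 2 ^ (n - 1 - j))
    (fun _ _ => Nat.zero_le _) (mem_range.2 hn))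
  simp [binaryDigit, hk]

theorem mem_reversiblePrimes {n p : ℕ} : p ∈ reversiblePrimes n ↔
    (2 ^ (n - 1) ≤ p ∧ p < 2 ^ n) ∧ p.Prime ∧ (binaryReversal n p).Prime := by
  rw [reversiblePrimes, mem_filter, mem_Ico]

theorem reversiblePrimeCount_le_two_pow (n : ℕ) : reversiblePrimeCount n ≤ 2 ^ n := by
  rw [reversiblePrimeCount, ← card_range (2 ^ n)]
  exact card_le_card fun p hp => mem_range.2 (mem_reversiblePrimes.1 hp).1.2

theorem sieveMass_pow_mul_reversiblePrimeCount_le {n P Q : ℕ} (hn : 3 ≤ n) (hQ : Q < 2 ^ (n - 1)) :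
    sieveMass P Q ^ 4 * reversiblePrimeCount n ≤
      ∑ k ∈ range (2 ^ n), ‖sieveWeight (sieveModuli P Q) k‖ ^ 2 *
        ‖sieveWeight (sieveModuli P Q) (binaryReversal n k)‖ ^ 2 := by
  have hS0 : 0 ≤ sieveMass P Q := sum_nonneg fun _ _ => by positivity
  have hw : ∀ k : ℕ, k.Prime → 2 ^ (n - 1) ≤ k →
      ‖sieveWeight (sieveModuli P Q) k‖ = sieveMass P Q := by
    intro k hk hle
    rw [sieveWeight_of_coprime (fun q hq => ?_) fun q hq => ?_, Complex.norm_real,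
      Real.norm_of_nonneg]
    · rfl
    · exact hS0
    · exact ⟨(mem_sieveModuli.1 hq).1.1, (mem_sieveModuli.1 hq).2.1⟩
    · have := (mem_sieveModuli.1 hq).1
      exact Nat.coprime_of_lt_prime (by omega) (by omega) hk
  have h4 : 4 ≤ 2 ^ (n - 1) := by
    calc 4 = 2 ^ 2 := by norm_num
      _ ≤ 2 ^ (n - 1) := Nat.pow_le_pow_right two_pos (by omega)
  calc sieveMass P Q ^ 4 * reversiblePrimeCount n
      = ∑ k ∈ reversiblePrimes n, sieveMass P Q ^ 4 := by
        rw [sum_const, nsmul_eq_mul, reversiblePrimeCount, mul_comm]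
    _ = ∑ k ∈ reversiblePrimes n, ‖sieveWeight (sieveModuli P Q) k‖ ^ 2 *
        ‖sieveWeight (sieveModuli P Q) (binaryReversal n k)‖ ^ 2 := by
        refine sum_congr rfl fun k hk => ?_
        obtain ⟨⟨hlo, -⟩, hp, hr⟩ := mem_reversiblePrimes.1 hk
        have hodd : k % 2 = 1 := hp.eq_two_or_odd.resolve_left (by omega)
        rw [hw k hp hlo, hw _ hr (two_pow_le_binaryReversal_of_odd (by omega) hodd)]
        ring
    _ ≤ _ := sum_le_sum_of_subset_of_nonneg
        (fun k hk => mem_range.2 (mem_reversiblePrimes.1 hk).1.2) fun _ _ _ => by positivity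

theorem exists_pow_mul_pow_sqrt_le :
    ∃ C : ℝ, 0 < C ∧ ∀ n : ℕ, (n : ℝ) ^ 11 * (143 / 144) ^ Nat.sqrt (n / 4) ≤ C := by
  have ht := tendsto_pow_const_mul_const_pow_of_abs_lt_one 22
    (r := (143 / 144 : ℝ)) (by rw [abs_of_pos] <;> norm_num)
  obtain ⟨b, hb⟩ := ht.bddAbove_range
  have hb' : ∀ k : ℕ, (k : ℝ) ^ 22 * (143 / 144) ^ k ≤ max b 1 := fun k =>
    (hb ⟨k, rfl⟩).trans (le_max_left _ _)
  refine ⟨4 ^ 11 * (2 * max b 1), by positivity, fun n => ?_⟩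
  set k := Nat.sqrt (n / 4) with hk
  have h1 : n ≤ 4 * (k + 1) ^ 2 := by
    have : n / 4 < (k + 1) ^ 2 := by rw [sq]; exact Nat.lt_succ_sqrt _
    omega
  have h2 : (n : ℝ) ≤ 4 * ((k : ℝ) + 1) ^ 2 := by exact_mod_cast h1
  have h3 := hb' (k + 1)
  push_cast at h3
  rw [pow_succ _ k] at h3
  calc (n : ℝ) ^ 11 * (143 / 144) ^ k ≤ (4 * ((k : ℝ) + 1) ^ 2) ^ 11 * (143 / 144) ^ k :=
        mul_le_mul_of_nonneg_right (pow_le_pow_left₀ (by positivity) h2 11) (by positivity)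
    _ = 4 ^ 11 * (((k : ℝ) + 1) ^ 22 * (143 / 144) ^ k) := by ring
    _ ≤ 4 ^ 11 * (2 * max b 1) := by
        refine mul_le_mul_of_nonneg_left ?_ (by positivity)
        have : (0 : ℝ) ≤ ((k : ℝ) + 1) ^ 22 * (143 / 144) ^ k := by positivity
        linarith

theorem harmonicSum_two_pow_le (t : ℕ) : harmonicSum (2 ^ t) ≤ t + 1 := by
  rw [harmonicSum_eq]
  refine (harmonic_le_one_add_log _).trans ?_
  push_cast
  rw [Real.log_pow]
  have := Real.log_two_lt_d9
  have : (0 : ℝ) ≤ t := Nat.cast_nonneg t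
  nlinarith

/-- The main estimate with unspecified error term `E`. -/
theorem reversiblePrimeCount_le {n B : ℕ} (hn : 16 ≤ n) (hB2 : 2 ≤ B)
    (hB : (2 : ℝ) ^ 6 ≤ (72 / 71) ^ B) {E : ℝ}
    (hE : (2 * (n / 16 : ℕ) + 1) *
      (128 * harmonicSum (2 ^ (n / 16)) ^ 6 * (143 / 144) ^ Nat.sqrt (n / 4)) ≤ E) :
    (reversiblePrimeCount n : ℝ) ≤
      2 ^ n * (1 / sieveMass (2 ^ B) (2 ^ (n / 16)) ^ 2 + 8 * Real.sqrt E + 16 * E) := by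
  set t := n / 16 with ht
  set m := n / 4 with hm
  set S := sieveMass (2 ^ B) (2 ^ t) with hS
  have hS1 : 1 ≤ S := one_le_sieveMass Nat.one_le_two_pow
  have hE0 : 0 ≤ E := by
    refine le_trans ?_ hE
    have : 0 ≤ harmonicSum (2 ^ t) := sum_nonneg fun _ _ => by positivity
    positivity
  have h1 := sieveMass_pow_mul_reversiblePrimeCount_le (n := n) (P := 2 ^ B) (Q := 2 ^ t)
    (by omega) (Nat.pow_lt_pow_right one_lt_two (by omega))
  have h2 := sum_norm_sq_sieveWeight_le (sieveModuli (2 ^ B) (2 ^ t)) n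
  have h3 := sum_sum_mul_cosProd_le_of_erase (n := n) (m := m) (by omega)
    (wellSpaced_diffSet (P := 2 ^ B) (t := t) (by omega)) (autocorr (sieveModuli (2 ^ B) (2 ^ t)))
    (autocorr_zero_le _) (fun a =>
      (sum_autocorr_sq_mul_rieszProd_le hB2 hB (by omega) a).trans hE)
  have h4 : S ^ 4 * reversiblePrimeCount n ≤
      2 ^ n * (S ^ 2 + 8 * S * Real.sqrt E + 16 * E) :=
    h1.trans (h2.trans (mul_le_mul_of_nonneg_left h3 (by positivity)))
  have hS4 : 0 < S ^ 4 := by positivity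
  refine le_of_mul_le_mul_left (h4.trans ?_) hS4
  have e : S ^ 4 * (2 ^ n * (1 / S ^ 2 + 8 * Real.sqrt E + 16 * E)) =
      2 ^ n * (S ^ 2 + 8 * S ^ 4 * Real.sqrt E + 16 * S ^ 4 * E) := by
    have : S ≠ 0 := by positivity
    field_simp
  rw [e]
  have h5 : S ≤ S ^ 4 := le_self_pow₀ hS1 (by norm_num)
  have h6 : 1 ≤ S ^ 4 := one_le_pow₀ hS1
  have h7 := Real.sqrt_nonneg E
  refine mul_le_mul_of_nonneg_left ?_ (by positivity)
  have h8 : 8 * S * Real.sqrt E ≤ 8 * S ^ 4 * Real.sqrt E := by gcongr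
  have h9 : 16 * E ≤ 16 * S ^ 4 * E := by nlinarith
  linarith

theorem mainTheorem2 :
    ∃ C : ℝ, 0 < C ∧ ∀ n : ℕ, 1 ≤ n →
      (reversiblePrimeCount n : ℝ) ≤ C * (2 ^ n / (n : ℝ) ^ 2) := by
  obtain ⟨B₀, hB₀⟩ := pow_unbounded_of_one_lt ((2 : ℝ) ^ 6) (show (1 : ℝ) < 72 / 71 by norm_num)
  set B := B₀ + 2 with hBdef
  have hB : (2 : ℝ) ^ 6 ≤ (72 / 71) ^ B :=
    hB₀.le.trans (pow_le_pow_right₀ (by norm_num) (by omega))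
  obtain ⟨C₁, hC₁, hsqrt⟩ := exists_pow_mul_pow_sqrt_le
  set D : ℝ := 2 * (2 ^ B).factorial + Real.log (2 ^ B).factorial with hD
  have hD0 : 0 < D := by
    have h1 : (1 : ℝ) ≤ (2 ^ B).factorial := by exact_mod_cast Nat.factorial_pos _
    have h2 := Real.log_nonneg h1
    positivity
  set K : ℝ := 256 * C₁ with hK
  refine ⟨256 + (64 * D) ^ 2 + 8 * Real.sqrt K + 16 * K, by positivity, fun n hn => ?_⟩
  have hn0 : (0 : ℝ) < n := by exact_mod_cast hn
  rw [mul_div_assoc', mul_comm _ ((2 : ℝ) ^ n), mul_div_assoc]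
  rcases lt_or_ge n 16 with hlt | hge
  · have h1 : (reversiblePrimeCount n : ℝ) ≤ 2 ^ n := by
      exact_mod_cast reversiblePrimeCount_le_two_pow n
    refine h1.trans (le_mul_of_one_le_right (by positivity) ?_)
    rw [one_le_div (by positivity)]
    have h2 : (n : ℝ) ≤ 16 := by exact_mod_cast hlt.le
    have h3 : (n : ℝ) ^ 2 ≤ 16 ^ 2 := pow_le_pow_left₀ hn0.le h2 2
    have h4 : 0 ≤ (64 * D) ^ 2 + 8 * Real.sqrt K + 16 * K := by positivity
    linarith
  · set t := n / 16 with ht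
    have htn : (t : ℝ) + 1 ≤ n := by exact_mod_cast (by omega : t + 1 ≤ n)
    have ht32 : (n : ℝ) ≤ 32 * t := by exact_mod_cast (by omega : n ≤ 32 * t)
    have hE : (2 * (t : ℝ) + 1) *
        (128 * harmonicSum (2 ^ t) ^ 6 * (143 / 144) ^ Nat.sqrt (n / 4)) ≤ K / (n : ℝ) ^ 4 := by
      have hh := harmonicSum_two_pow_le t
      have hh0 : 0 ≤ harmonicSum (2 ^ t) := sum_nonneg fun _ _ => by positivity
      have hh6 : harmonicSum (2 ^ t) ^ 6 ≤ (n : ℝ) ^ 6 := pow_le_pow_left₀ hh0 (hh.trans htn) 6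
      rw [le_div_iff₀ (by positivity)]
      calc (2 * (t : ℝ) + 1) *
            (128 * harmonicSum (2 ^ t) ^ 6 * (143 / 144) ^ Nat.sqrt (n / 4)) * (n : ℝ) ^ 4
          ≤ (2 * n) * (128 * (n : ℝ) ^ 6 * (143 / 144) ^ Nat.sqrt (n / 4)) * (n : ℝ) ^ 4 := by
            gcongr
            linarith
        _ = 256 * ((n : ℝ) ^ 11 * (143 / 144) ^ Nat.sqrt (n / 4)) := by ring
        _ ≤ K := by
            have := hsqrt n
            rw [hK]
            linarith
    have hmain := reversiblePrimeCount_le hge (by omega) hB hE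
    refine hmain.trans (mul_le_mul_of_nonneg_left ?_ (by positivity))
    have hS1 : 1 ≤ sieveMass (2 ^ B) (2 ^ t) := one_le_sieveMass Nat.one_le_two_pow
    have hS : 1 / sieveMass (2 ^ B) (2 ^ t) ^ 2 ≤ (64 * D) ^ 2 / (n : ℝ) ^ 2 := by
      have h1 := log_le_sieveMass (2 ^ B) (Q := 2 ^ t) Nat.one_le_two_pow
      push_cast at h1
      rw [Real.log_pow] at h1
      have h2 := Real.log_two_gt_d9
      have h3 : (n : ℝ) ≤ 64 * D * sieveMass (2 ^ B) (2 ^ t) := by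
        have : (0 : ℝ) ≤ t := Nat.cast_nonneg t
        nlinarith
      rw [div_le_div_iff₀ (by positivity) (by positivity), one_mul, ← mul_pow]
      exact pow_le_pow_left₀ hn0.le h3 2
    have hsq : Real.sqrt (K / (n : ℝ) ^ 4) = Real.sqrt K / (n : ℝ) ^ 2 := by
      rw [Real.sqrt_div (by positivity), show (n : ℝ) ^ 4 = ((n : ℝ) ^ 2) ^ 2 by ring,
        Real.sqrt_sq (by positivity)]
    have hK4 : K / (n : ℝ) ^ 4 ≤ K / (n : ℝ) ^ 2 := by
      refine div_le_div_of_nonneg_left (by positivity) (by positivity) ?_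
      exact pow_le_pow_right₀ (by exact_mod_cast hn) (by norm_num)
    rw [hsq]
    have h256 : 0 ≤ 256 / (n : ℝ) ^ 2 := by positivity
    have e : (256 + (64 * D) ^ 2 + 8 * Real.sqrt K + 16 * K) / (n : ℝ) ^ 2 =
        256 / (n : ℝ) ^ 2 + (64 * D) ^ 2 / (n : ℝ) ^ 2 + 8 * (Real.sqrt K / (n : ℝ) ^ 2) +
          16 * (K / (n : ℝ) ^ 2) := by ring
    rw [e]
    linarith
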